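/- **Setting.** Let $d\ge 1$, let $S\subset\mathbb Z^d$ generate $\mathbb Z^d$ positively (every $v\in\mathbb Z^d$ is a finite sum of elements of $S$), and let $L_s$ ($s\in S$) be operators on $\mathfrak h=\mathbb C^2$ with $\sum_{s\in S}L_s^*L_s=\mathrm{Id}$ (a homogeneous open quantum random walk on $\mathbb Z^d$). Put $\mathfrak L(\rho)=\sum_{s}L_s\rho L_s^*$ and, for $u\in\mathbb R^d$, $L_s^{(u)}=e^{\langle u,s\rangle/2}L_s$ and $\mathfrak L_u(\rho)=\sum_s L_s^{(u)}\rho L_s^{(u)*}$; it is assumed that $\sum_s L_s^{(u)*}L_s^{(u)}$ converges for every $u\in\mathbb R^d$, so that all $\mathfrak L_u$ are defined (this is automatic when $S$ is finite). Let $\lambda_u$ be the spectral radius of $\mathfrak L_u$. For an initial state $\sum_{i\in\mathbb Z^d}\rho(i)\otimes|i\rangle\langle i|$ ($\rho(i)\ge 0$, $\sum_i\mathrm{Tr}\,\rho(i)=1$), the position process $(X_p)_{p\ge0}$ is the coordinate process on $(\mathbb Z^d)^{\mathbb N}$ under the unique probability $\mathbb P$ with $$\mathbb P(X_0=i_0,\dots,X_p=i_p)=\mathrm{Tr}\big(L_{s_p}\cdots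 L_{s_1}\rho(i_0)L_{s_1}^*\cdots L_{s_p}^*\big)$$ if all $s_k=i_k-i_{k-1}$ belong to $S$, and $0$ otherwise. The map $\mathfrak L$ is irreducible if $\{0\}$ and $\mathfrak h$ are the only subspaces invariant under all $L_s$. Its period is the supremum of the $n\ge1$ for which there are orthogonal projections $P_0,\dots,P_{n-1}$ with $\sum_jP_j=\mathrm{Id}$ and $P_jL_s=L_sP_{j-1}$ for all $j,s$ (indices modulo $n$); $\mathfrak L$ is periodic if its period is greater than $1$. **Statement.** Assume H1: the ranges of the $L_s$ span $\mathfrak h$; H2: the $L_s$ are not all proportional to the identity; and that $\mathfrak L$ is irreducible and periodic. Then there is an orthonormal basis of $\mathfrak h$ in which $$L_s=\begin{pmatrix}0&\gamma_s\\ \nu_s&0\end{pmatrix}\qquad\text{for all }s\in S.$$ For every such basis, $\sum_s|\nu_s|^2=\sum_s|\gamma_s|^2=1$. Let $A$ and $B$ be random variables with $\mathbb P(A=s)=|\nu_s|^2$ and $\mathbb P(B=s)=|\gamma_s|^2$. Then for all $u\in\mathbb R^d$ the expectations below are finite, $$\lambda_u=\sqrt{\mathbb E e^{\langle u,A\rangle}\;\mathbb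 E e^{\langle u,B\rangle}},\qquad c(u):=\log\lambda_u=\tfrac12\big(\log\mathbb E e^{\langle u,A\rangle}+\log\mathbb E e^{\langle u,B\rangle}\big),$$ and, for every initial state, 1. $\mathbb E e^{\langle u,X_p-X_0\rangle}<\infty$ for all $p$ and $u$, and $\lim_{p\to\infty}\frac1p\log\mathbb E e^{\langle u,X_p-X_0\rangle}=c(u)$ for all $u$; 2. $\big(\frac1p(X_p-X_0)\big)_{p\ge1}$ satisfies a full large deviation principle with good rate function the Legendre transform $I(x)=\sup_{u\in\mathbb R^d}(\langle u,x\rangle-c(u))$: $I:\mathbb R^d\to[0,\infty]$ is lower semicontinuous with compact level sets $\{I\le\alpha\}$, $\alpha\in\mathbb R$, and for all open $G$ and closed $F$ in $\mathbb R^d$ $$-\inf_{G}I\le\liminf_{p\to\infty}\tfrac1p\log\mathbb P\big(\tfrac{X_p-X_0}p\in G\big),\qquad \limsup_{p\to\infty}\tfrac1p\log\mathbb P\big(\tfrac{X_p-X_0}p\in F\big)\le-\inf_{F}I .$$ -/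

import Mathlib

open MeasureTheory Filter Topology
open scoped ENNReal Matrix ComplexOrder

noncomputable section

namespace OpenQRW

/-- The lattice `ℤ^d`. -/
abbrev Lattice (d : ℕ) : Type := Fin d → ℤ

/-- The ambient Euclidean space `ℝ^d`. -/
abbrev Space (d : ℕ) : Type := EuclideanSpace ℝ (Fin d)

/-- Operators on the internal space `ℂ²`, written in the canonical basis. -/
abbrev Op : Type := Matrix (Fin 2) (Fin 2) ℂ

/-- The inclusion `ℤ^d ⊂ ℝ^d`. -/
def toSpace {d : ℕ} (v : Lattice d) : Space d := WithLp.toLp 2 fun i => (v i : ℝ)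

/-- The scalar product `⟨u, v⟩` of `u ∈ ℝ^d` and `v ∈ ℤ^d`. -/
def pairing {d : ℕ} (u : Space d) (v : Lattice d) : ℝ := inner ℝ u (toSpace v)

/-! ### Existence and uniqueness of a probability on path space with given cylinder weights -/

section PathSpace

open ProbabilityTheory Preorder

lemma frestrictLe_preimage {V : Type} (n : ℕ) (x : ℕ → V) :
    frestrictLe (π := fun _ => V) n ⁻¹' {frestrictLe (π := fun _ => V) n x}
      = {y : ℕ → V | ∀ k ≤ n, y k = x k} := by
  ext y
  simp only [Set.mem_preimage, Set.mem_singleton_iff, Set.mem_ofPred_eq]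
  constructor
  · intro h k hk
    exact congrFun h ⟨k, Finset.mem_Iic.2 hk⟩
  · intro h
    funext k
    exact h k.1 (Finset.mem_Iic.1 k.2)

variable {V : Type} [MeasurableSpace V] [DiscreteMeasurableSpace V] [Countable V] [Inhabited V]

/-- Extend a finite history to an infinite path. -/
def extendHistory {n : ℕ} (h : (i : Finset.Iic n) → V) : ℕ → V :=
  fun k => if hk : k ∈ Finset.Iic n then h ⟨k, hk⟩ else default

lemma measure_path_ext {P Q : Measure (ℕ → V)} [IsProbabilityMeasure P] [IsProbabilityMeasure Q]
    (h : ∀ (n : ℕ) (x : ℕ → V), P {y | ∀ k ≤ n, y k = x k} = Q {y | ∀ k ≤ n, y k = x k}) :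
    P = Q := by
  have key : ∀ n : ℕ, P.map (frestrictLe (π := fun _ => V) n)
      = Q.map (frestrictLe (π := fun _ => V) n) := by
    intro n
    refine Measure.ext_of_singleton fun a => ?_
    have ha : a = frestrictLe (π := fun _ => V) n (extendHistory a) := by
      funext k
      simp [extendHistory, frestrictLe_apply]
    rw [Measure.map_apply (measurable_frestrictLe n) (measurableSet_singleton _),
      Measure.map_apply (measurable_frestrictLe n) (measurableSet_singleton _), ha,
      frestrictLe_preimage]
    exact h n _
  have hproj : ∀ R : Measure (ℕ → V), IsProjectiveMeasureFamily
      (α := fun _ : ℕ => V) (fun I : Finset ℕ => R.map (I.restrict (π := fun _ => V))) := by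
    intro R I J hJ
    rw [Measure.map_map (by fun_prop) (by fun_prop)]
    rfl
  have hP : IsProjectiveLimit (α := fun _ : ℕ => V) P (fun I : Finset ℕ =>
      Q.map (I.restrict (π := fun _ => V))) :=
    (isProjectiveLimit_nat_iff (hproj Q) P).2 key
  have hQ : IsProjectiveLimit (α := fun _ : ℕ => V) Q (fun I : Finset ℕ =>
      Q.map (I.restrict (π := fun _ => V))) :=
    fun I => rfl
  have : ∀ I : Finset ℕ, IsFiniteMeasure (Q.map (I.restrict (π := fun _ => V))) :=
    fun I => inferInstance
  exact hP.unique hQ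

/-- A consistent family of cylinder weights extends uniquely to a probability on path space. -/
theorem existsUnique_pathMeasure (q : ℕ → (ℕ → V) → ℝ≥0∞)
    (hdep : ∀ n x y, (∀ k ≤ n, x k = y k) → q n x = q n y)
    (hinit : ∀ x, ∑' v, q 0 (Function.update x 0 v) = 1)
    (hstep : ∀ n x, ∑' v, q (n + 1) (Function.update x (n + 1) v) = q n x) :
    ∃! P : Measure (ℕ → V), IsProbabilityMeasure P ∧
      ∀ (n : ℕ) (x : ℕ → V), P {y | ∀ k ≤ n, y k = x k} = q n x := by
  classical
  have hle : ∀ n x, q n x ≤ 1 := by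
    intro n
    induction n with
    | zero =>
      intro x
      calc q 0 x = q 0 (Function.update x 0 (x 0)) := by rw [Function.update_eq_self]
        _ ≤ ∑' v, q 0 (Function.update x 0 v) := ENNReal.le_tsum (x 0)
        _ = 1 := hinit x
    | succ n ih =>
      intro x
      calc q (n + 1) x = q (n + 1) (Function.update x (n + 1) (x (n + 1))) := by
            rw [Function.update_eq_self]
        _ ≤ ∑' v, q (n + 1) (Function.update x (n + 1) v) := ENNReal.le_tsum (x (n + 1))
        _ = q n x := hstep n x
        _ ≤ 1 := ih x
  let μ₀ : Measure V :=
    Measure.sum fun v => q 0 (Function.update (fun _ => default) 0 v) • Measure.dirac v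
  have hμ₀s : ∀ v, μ₀ {v} = q 0 (Function.update (fun _ => default) 0 v) := by
    intro v
    simp only [μ₀]
    rw [Measure.sum_smul_dirac_singleton]
  have hμ₀ : IsProbabilityMeasure μ₀ := by
    constructor
    simp only [μ₀]
    rw [Measure.sum_apply _ MeasurableSet.univ]
    simpa using hinit _
  let step : (n : ℕ) → ((i : Finset.Iic n) → V) → Measure V := fun n h =>
    if q n (extendHistory h) = 0 then Measure.dirac default
    else Measure.sum fun v =>
      (q (n + 1) (Function.update (extendHistory h) (n + 1) v) / q n (extendHistory h)) •
        Measure.dirac v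
  let κ : (n : ℕ) → Kernel ((i : Finset.Iic n) → V) V := fun n => ⟨step n, .of_discrete⟩
  have hκ : ∀ n h, κ n h = step n h := fun n h => rfl
  have : ∀ n, IsMarkovKernel (κ n) := by
    intro n
    refine ⟨fun h => ?_⟩
    rw [hκ]
    by_cases h0 : q n (extendHistory h) = 0
    · simp only [step, if_pos h0]
      infer_instance
    · simp only [step, if_neg h0]
      constructor
      rw [Measure.sum_apply _ MeasurableSet.univ]
      simp only [Measure.smul_apply, measure_univ, smul_eq_mul, mul_one]
      simp only [div_eq_mul_inv]
      rw [ENNReal.tsum_mul_right, hstep]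
      exact ENNReal.mul_inv_cancel h0 (ne_top_of_le_ne_top ENNReal.one_ne_top (hle _ _))
  let P : Measure (ℕ → V) := Kernel.trajMeasure (X := fun _ => V) μ₀ κ
  have hP : IsProbabilityMeasure P := by
    simp only [P]
    infer_instance
  have hcyl : ∀ (n : ℕ) (x : ℕ → V), P {y | ∀ k ≤ n, y k = x k} = q n x := by
    intro n
    induction n with
    | zero =>
      intro x
      have h0 : P.map (frestrictLe (π := fun _ => V) 0)
          = μ₀.map (MeasurableEquiv.piUnique (fun _ : Finset.Iic 0 => V)).symm := by
        simp only [P, Kernel.trajMeasure]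
        rw [Measure.map_comp _ _ (by fun_prop), Kernel.traj_map_frestrictLe,
          Kernel.partialTraj_self, Measure.id_comp]
      rw [← frestrictLe_preimage, ← Measure.map_apply (measurable_frestrictLe 0)
        (measurableSet_singleton _), h0, Measure.map_apply (by fun_prop)
        (measurableSet_singleton _)]
      have : (MeasurableEquiv.piUnique (fun _ : Finset.Iic 0 => V)).symm ⁻¹'
          {frestrictLe (π := fun _ => V) 0 x} = {x 0} := by
        ext v
        simp only [Set.mem_preimage, Set.mem_singleton_iff]
        rw [MeasurableEquiv.symm_apply_eq]
        rfl
      rw [this, hμ₀s]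
      refine hdep 0 _ _ fun k hk => ?_
      obtain rfl : k = 0 := by omega
      simp
    | succ n ih =>
      intro x
      have hcomp := Kernel.map_frestrictLe_trajMeasure_compProd_eq_map_trajMeasure
        (X := fun _ => V) (μ₀ := μ₀) (κ := κ) (a := n)
      have hset : {y : ℕ → V | ∀ k ≤ n + 1, y k = x k}
          = (fun y : ℕ → V => (frestrictLe (π := fun _ => V) n y, y (n + 1))) ⁻¹'
            ({frestrictLe (π := fun _ => V) n x} ×ˢ {x (n + 1)}) := by
        rw [Set.mk_preimage_prod, frestrictLe_preimage]
        ext y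
        simp only [Set.mem_ofPred_eq, Set.mem_inter_iff, Set.mem_preimage, Set.mem_singleton_iff]
        constructor
        · exact fun h => ⟨fun k hk => h k (by omega), h _ le_rfl⟩
        · rintro ⟨h, h'⟩ k hk
          rcases Nat.lt_or_ge n k with hk' | hk'
          · obtain rfl : k = n + 1 := by omega
            exact h'
          · exact h k hk'
      have hmap : P.map (fun y : ℕ → V => (frestrictLe (π := fun _ => V) n y, y (n + 1)))
          = (P.map (frestrictLe (π := fun _ => V) n)) ⊗ₘ κ n := hcomp.symm
      have hext : ∀ k ≤ n, extendHistory (frestrictLe (π := fun _ => V) n x) k = x k := by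
        intro k hk
        simp [extendHistory, hk]
      have hqn : q n (extendHistory (frestrictLe (π := fun _ => V) n x)) = q n x :=
        hdep _ _ _ hext
      have hqn1 : q (n + 1) (Function.update
          (extendHistory (frestrictLe (π := fun _ => V) n x)) (n + 1) (x (n + 1)))
          = q (n + 1) x := by
        refine hdep _ _ _ fun k hk => ?_
        rcases Nat.lt_or_ge n k with hk' | hk'
        · obtain rfl : k = n + 1 := by omega
          simp
        · rw [Function.update_of_ne (by omega)]
          exact hext k hk'
      rw [hset, ← Measure.map_apply (by fun_prop)
        ((measurableSet_singleton _).prod (measurableSet_singleton _)), hmap,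
        Measure.compProd_apply_prod (measurableSet_singleton _) (measurableSet_singleton _),
        lintegral_singleton, Measure.map_apply (measurable_frestrictLe n)
        (measurableSet_singleton _), frestrictLe_preimage, ih, hκ]
      by_cases h0 : q n x = 0
      · rw [h0, mul_zero]
        symm
        rw [← nonpos_iff_eq_zero]
        calc q (n + 1) x = q (n + 1) (Function.update x (n + 1) (x (n + 1))) := by
              rw [Function.update_eq_self]
          _ ≤ ∑' v, q (n + 1) (Function.update x (n + 1) v) := ENNReal.le_tsum (x (n + 1))
          _ = q n x := hstep n x
          _ ≤ 0 := h0.le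
      · simp only [step, hqn, if_neg h0]
        rw [Measure.sum_smul_dirac_singleton, hqn1]
        exact ENNReal.div_mul_cancel h0 (ne_top_of_le_ne_top ENNReal.one_ne_top (hle _ _))
  refine ⟨P, ⟨hP, hcyl⟩, ?_⟩
  rintro Q ⟨hQ, hQc⟩
  exact measure_path_ext fun n x => by rw [hQc, hcyl]

end PathSpace

/-! ### Completely positive maps in Kraus form -/

lemma summable_normSq_entry {ι : Type} {A : ι → Op} (hA : Summable fun s => (A s)ᴴ * A s)
    (i k : Fin 2) : Summable fun s => ‖A s i k‖ ^ 2 := by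
  have h1 : Summable fun s => ((A s)ᴴ * A s) k k := Pi.summable.1 (Pi.summable.1 hA k) k
  refine Summable.of_nonneg_of_le (fun s => by positivity) (fun s => ?_) h1.norm
  have h2 : ((A s)ᴴ * A s) k k = ((∑ j, ‖A s j k‖ ^ 2 : ℝ) : ℂ) := by
    simp [Matrix.mul_apply, Complex.conj_mul']
  rw [h2, Complex.norm_real, Real.norm_of_nonneg (by positivity)]
  exact Finset.single_le_sum (f := fun j => ‖A s j k‖ ^ 2) (fun j _ => by positivity)
    (Finset.mem_univ i)

lemma summable_kraus {ι : Type} {A : ι → Op} (hA : Summable fun s => (A s)ᴴ * A s) (ρ : Op) :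
    Summable fun s => A s * ρ * (A s)ᴴ := by
  refine Pi.summable.2 fun i => Pi.summable.2 fun j => ?_
  simp only [Matrix.mul_apply, Matrix.conjTranspose_apply, Finset.sum_mul]
  refine summable_sum fun l _ => summable_sum fun k _ => ?_
  have h : Summable fun s => A s i k * star (A s j l) := by
    refine Summable.of_norm_bounded
      ((summable_normSq_entry hA i k).add (summable_normSq_entry hA j l)) fun s => ?_
    rw [norm_mul, norm_star]
    nlinarith [sq_nonneg (‖A s i k‖ - ‖A s j l‖), sq_nonneg (‖A s i k‖), sq_nonneg (‖A s j l‖)]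
  refine (h.mul_left (ρ k l)).congr fun s => ?_
  ring

/-- The completely positive map `ρ ↦ ∑ₛ Aₛ ρ Aₛ*`, for a family with `∑ₛ Aₛ* Aₛ` convergent. -/
def krausMap {ι : Type} (A : ι → Op) (hA : Summable fun s => (A s)ᴴ * A s) :
    Module.End ℂ Op where
  toFun ρ := ∑' s, A s * ρ * (A s)ᴴ
  map_add' ρ σ := by
    rw [← (summable_kraus hA ρ).tsum_add (summable_kraus hA σ)]
    exact tsum_congr fun s => by rw [Matrix.mul_add, Matrix.add_mul]
  map_smul' c ρ := by
    rw [RingHom.id_apply, ← (summable_kraus hA ρ).tsum_const_smul c]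
    exact tsum_congr fun s => by rw [Matrix.mul_smul, Matrix.smul_mul]

/-- Irreducibility of the completely positive map with Kraus operators `Aₛ`: the only subspaces
invariant under all `Aₛ` are `{0}` and the whole space. -/
def IsIrreducible {ι : Type} (A : ι → Op) : Prop :=
  ∀ E : Submodule ℂ (Fin 2 → ℂ), (∀ s, ∀ x ∈ E, A s *ᵥ x ∈ E) → E = ⊥ ∨ E = ⊤

/-- `(P₀, …, Pₙ)` is a cyclic resolution of the identity with `n + 1` elements for the Kraus
operators `Aₛ`: orthogonal projections with sum `1` and `Pⱼ Aₛ = Aₛ Pⱼ₋₁`, where `j - 1` is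
taken modulo `n + 1`. -/
structure IsCyclicResolution {ι : Type} (A : ι → Op) (n : ℕ) (P : Fin (n + 1) → Op) : Prop where
  isHermitian : ∀ j, (P j).IsHermitian
  idempotent : ∀ j, P j * P j = P j
  sum_eq_one : ∑ j, P j = 1
  cyclic : ∀ j s, P j * A s = A s * P (j - 1)

/-- The period: the supremum of the lengths of the cyclic resolutions of the identity. -/
def period {ι : Type} (A : ι → Op) : ℕ∞ :=
  ⨆ (n : ℕ) (_ : ∃ P, IsCyclicResolution A n P), ((n + 1 : ℕ) : ℕ∞)

/-- A map which is not aperiodic, i.e. has period greater than one. -/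
def IsPeriodic {ι : Type} (A : ι → Op) : Prop := 1 < period A

/-! ### Open quantum random walks on `ℤ^d` with internal space `ℂ²` -/

/-- A homogeneous open quantum random walk on `ℤ^d` with internal space `ℂ²`: a set `S` of steps
which positively generates `ℤ^d`, and transition operators `L s`, `s ∈ S` (extended by `0` outside
`S`), with `∑ₛ Lₛ* Lₛ = 1`. -/
structure OQRW (d : ℕ) where
  S : Set (Lattice d)
  generates : AddSubmonoid.closure S = ⊤
  L : Lattice d → Op
  L_eq_zero : ∀ s, s ∉ S → L s = 0
  hasSum_one : HasSum (fun s => (L s)ᴴ * L s) 1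

/-- An initial state `∑ᵢ ρ(i) ⊗ |i⟩⟨i|`: positive operators `ρ(i)` with `∑ᵢ Tr ρ(i) = 1`. -/
structure InitialState (d : ℕ) where
  op : Lattice d → Op
  posSemidef : ∀ i, (op i).PosSemidef
  hasSum_trace : HasSum (fun i => (op i).trace) 1

namespace OQRW

variable {d : ℕ} (W : OQRW d)

/-- The closed span of the ranges of the transition operators is the whole internal space. -/
def H1 : Prop := ⨆ s ∈ W.S, LinearMap.range (Matrix.toLin' (W.L s)) = ⊤

/-- The transition operators are not all proportional to the identity. -/
def H2 : Prop := ¬ ∀ s ∈ W.S, ∃ c : ℂ, W.L s = c • (1 : Op)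

/-- The unnormalised internal state `Lₛₙ ⋯ Lₛ₁ ρ(i₀) Lₛ₁* ⋯ Lₛₙ*` along the path
`i₀, i₁, …, iₙ`, where `sₖ = iₖ - iₖ₋₁`. -/
def trajectoryState (ρ : InitialState d) (i : ℕ → Lattice d) : ℕ → Op
  | 0 => ρ.op (i 0)
  | n + 1 => W.L (i (n + 1) - i n) * trajectoryState ρ i n * (W.L (i (n + 1) - i n))ᴴ

/-- The probability of observing the positions `i₀, …, iₙ` at times `0, …, n`. -/
def trajectoryWeight (ρ : InitialState d) (n : ℕ) (i : ℕ → Lattice d) : ℝ≥0∞ :=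
  ENNReal.ofReal (W.trajectoryState ρ i n).trace.re

lemma trajectoryState_congr (ρ : InitialState d) (n : ℕ) (i j : ℕ → Lattice d)
    (h : ∀ k ≤ n, i k = j k) : W.trajectoryState ρ i n = W.trajectoryState ρ j n := by
  induction n with
  | zero => simp [trajectoryState, h 0 le_rfl]
  | succ n ih =>
    simp only [trajectoryState]
    rw [ih fun k hk => h k (by omega), h (n + 1) le_rfl, h n (by omega)]

lemma trajectoryState_posSemidef (ρ : InitialState d) (n : ℕ) (i : ℕ → Lattice d) :
    (W.trajectoryState ρ i n).PosSemidef := by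
  induction n with
  | zero => exact ρ.posSemidef _
  | succ n ih => exact ih.mul_mul_conjTranspose_same _

lemma tsum_ofReal_trace {ι : Type} {f : ι → Op} {t : ℂ} (hf : ∀ s, (f s).PosSemidef)
    (h : HasSum (fun s => (f s).trace) t) :
    ∑' s, ENNReal.ofReal (f s).trace.re = ENNReal.ofReal t.re := by
  have h1 : HasSum (fun s => (f s).trace.re) t.re := Complex.hasSum_re h
  rw [← h1.tsum_eq, ENNReal.ofReal_tsum_of_nonneg _ h1.summable]
  exact fun s => (Complex.le_def.1 (hf s).trace_nonneg).1

lemma hasSum_trace_step (σ : Op) :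
    HasSum (fun s => (W.L s * σ * (W.L s)ᴴ).trace) σ.trace := by
  have h1 : HasSum (fun s => ((W.L s)ᴴ * W.L s) * σ) (1 * σ) :=
    W.hasSum_one.map (AddMonoidHom.mulRight σ) (continuous_id.matrix_mul continuous_const)
  have h2 : HasSum (fun s => (((W.L s)ᴴ * W.L s) * σ).trace) (1 * σ).trace :=
    h1.map (Matrix.traceAddMonoidHom (Fin 2) ℂ) continuous_id.matrix_trace
  rw [one_mul] at h2
  refine h2.congr_fun fun s => ?_
  rw [Matrix.trace_mul_comm, ← Matrix.mul_assoc]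

/-- The trajectory weights are the cylinder probabilities of a unique probability on path space. -/
theorem existsUnique_law (ρ : InitialState d) :
    ∃! P : Measure (ℕ → Lattice d), IsProbabilityMeasure P ∧
      ∀ (n : ℕ) (i : ℕ → Lattice d),
        P {ω | ∀ k ≤ n, ω k = i k} = W.trajectoryWeight ρ n i := by
  refine existsUnique_pathMeasure (W.trajectoryWeight ρ) ?_ ?_ ?_
  · intro n x y h
    simp only [trajectoryWeight, W.trajectoryState_congr ρ n x y h]
  · intro x
    simpa [trajectoryWeight, trajectoryState] using
      tsum_ofReal_trace ρ.posSemidef ρ.hasSum_trace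
  · intro n x
    have hx : ∀ v, W.trajectoryState ρ (Function.update x (n + 1) v) n
        = W.trajectoryState ρ x n := fun v =>
      W.trajectoryState_congr ρ n _ _ fun k hk => Function.update_of_ne (by omega) _ _
    have hn : ∀ v, Function.update x (n + 1) v n = x n := fun v =>
      Function.update_of_ne (by omega) _ _
    simp only [trajectoryWeight, trajectoryState, hx, hn, Function.update_self]
    rw [← (Equiv.addRight (x n)).tsum_eq]
    simp only [Equiv.coe_addRight, add_sub_cancel_right]
    exact tsum_ofReal_trace
      (fun s => (W.trajectoryState_posSemidef ρ n x).mul_mul_conjTranspose_same _)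
      (W.hasSum_trace_step _)

/-- The law on `(ℤ^d)^ℕ` of the position process `(X_p)` (the coordinate maps) started from the
initial state `ρ`: the unique probability with
`P(X₀ = i₀, …, Xₙ = iₙ) = Tr (Lₛₙ ⋯ Lₛ₁ ρ(i₀) Lₛ₁* ⋯ Lₛₙ*)`, `sₖ = iₖ - iₖ₋₁`. -/
def law (ρ : InitialState d) : Measure (ℕ → Lattice d) := (W.existsUnique_law ρ).choose

lemma law_spec (ρ : InitialState d) : IsProbabilityMeasure (W.law ρ) ∧
    ∀ (n : ℕ) (i : ℕ → Lattice d),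
      W.law ρ {ω | ∀ k ≤ n, ω k = i k} = W.trajectoryWeight ρ n i :=
  (W.existsUnique_law ρ).choose_spec.1

/-- The deformed transition operators `Lₛ⁽ᵘ⁾ = e^{⟨u,s⟩/2} Lₛ`. -/
def tilted (u : Space d) (s : Lattice d) : Op := Real.exp (pairing u s / 2) • W.L s

/-- For every `u` the deformed operators are again the Kraus operators of a completely positive
map, i.e. `∑ₛ Lₛ⁽ᵘ⁾* Lₛ⁽ᵘ⁾` converges. This is automatic when `S` is finite. -/
def HasDeformations : Prop :=
  ∀ u : Space d, Summable fun s => (W.tilted u s)ᴴ * W.tilted u s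

lemma hasDeformations_of_finite (h : W.S.Finite) : W.HasDeformations := by
  intro u
  refine summable_of_hasFiniteSupport (h.subset fun s hs => ?_)
  by_contra hS
  exact hs (by simp [tilted, W.L_eq_zero s hS])

/-- The deformed map `𝔏_u : ρ ↦ ∑ₛ Lₛ⁽ᵘ⁾ ρ Lₛ⁽ᵘ⁾*`. -/
def deformed (hW : W.HasDeformations) (u : Space d) : Module.End ℂ Op :=
  krausMap (W.tilted u) (hW u)

/-- In the orthonormal basis given by the columns of the unitary `U`, every `Lₛ` is
`(0, γₛ; νₛ, 0)`. -/
def IsAntidiagonalIn (U : Matrix.unitaryGroup (Fin 2) ℂ) (ν γ : Lattice d → ℂ) : Prop :=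
  ∀ s, (U : Op)ᴴ * W.L s * (U : Op) = !![0, γ s; ν s, 0]

end OQRW

/-- The distribution on `ℤ^d` with `P({s}) = |aₛ|²`. -/
def stepLaw {d : ℕ} (a : Lattice d → ℂ) : Measure (Lattice d) :=
  Measure.sum fun s => ENNReal.ofReal (‖a s‖ ^ 2) • Measure.dirac s

/-- The law of `(X_p - X_0) / p` when the path `(X_p)` has law `P`. -/
def meanDisplacementLaw {d : ℕ} (P : Measure (ℕ → Lattice d)) (p : ℕ) : Measure (Space d) :=
  P.map fun ω => (1 / (p : ℝ)) • toSpace (ω p - ω 0)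

/-- The Legendre transform `x ↦ sup_u (⟨u, x⟩ - c(u))`. -/
def legendre {d : ℕ} (c : Space d → ℝ) (x : Space d) : EReal :=
  ⨆ u : Space d, ((inner ℝ u x - c u : ℝ) : EReal)

/-- The measures `μ_p` satisfy a full large deviation principle at speed `p` with good rate
function `I`. -/
structure IsFullLDP {d : ℕ} (μ : ℕ → Measure (Space d)) (I : Space d → EReal) : Prop where
  nonneg : ∀ x, 0 ≤ I x
  lowerSemicontinuous : LowerSemicontinuous I
  isCompact_level : ∀ α : ℝ, IsCompact {x | I x ≤ (α : EReal)}
  lower : ∀ G : Set (Space d), IsOpen G →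
    -(⨅ x ∈ G, I x) ≤ liminf (fun p : ℕ => ENNReal.log (μ p G) / (p : EReal)) atTop
  upper : ∀ F : Set (Space d), IsClosed F →
    limsup (fun p : ℕ => ENNReal.log (μ p F) / (p : EReal)) atTop ≤ -(⨅ x ∈ F, I x)

end OpenQRW

end

/-!
In an antidiagonal basis each transition exchanges the two basis states, so the walk has a classical
description: from the first basis state its steps are independent with laws alternating between
those of `A` and `B`, from the second they alternate between those of `B` and `A`, and the law of the
displacement is the mixture of the two given by the diagonal of the initial state.

Such a basis exists because a cyclic resolution of length at least two in dimension two consists of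
two projections `P₀`, `1 - P₀` of rank one; diagonalising `P₀` kills the diagonal entries of every
`Lₛ` (`H1.exists_isAntidiagonalIn`). The deformed map then acts on the diagonal and on the
off-diagonal entries separately, its square being scalar on each of the two, with scalars
`E e^{⟨u,A⟩} E e^{⟨u,B⟩}` and a number that Cauchy–Schwarz shows to be no larger
(`IsAntidiagonalIn.spectralRadius_deformed`).

The moment generating function of the displacement is a mixture of two alternating products
(`IsAntidiagonalIn.exists_integral_exp_displacement`), each of which is `e^{p c(u)}` up to a bounded
factor (`tendsto_log_mixture`). The limit `c` is finite, continuous and differentiable along lines,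
and the large deviation principle follows from the Gärtner–Ellis theorem
(`HasScaledCumulantLimit.isFullLDP`). In its lower bound no steepness is needed: a point `x` of
finite rate is approximated by gradients of `c`, namely at the maximisers of
`⟨u, x⟩ - c(u) - ε‖u‖² / 2`, whose rates do not exceed that of `x`
(`HasScaledCumulantLimit.exists_gradient_near`).
-/

noncomputable section

namespace OpenQRW

/-! ### The Gärtner–Ellis theorem for everywhere differentiable limits -/

section GartnerEllis

variable {d : ℕ}

/-- Exponential moments of the probability measures `μ_p`, scaled by `p`, are finite and grow
like `e^{p c(u)}`. -/
structure HasScaledCumulantLimit (μ : ℕ → Measure (Space d)) (c : Space d → ℝ) : Prop where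
  isProbabilityMeasure : ∀ p, IsProbabilityMeasure (μ p)
  integrable : ∀ u (p : ℕ), Integrable (fun x => Real.exp (p * inner ℝ u x)) (μ p)
  tendsto : ∀ u, Tendsto (fun p : ℕ => 1 / (p : ℝ) * Real.log
    (∫ x, Real.exp (p * inner ℝ u x) ∂μ p)) atTop (𝓝 (c u))

lemma log_div_le {m : ℝ≥0∞} {p : ℕ} (hp : 0 < p) {b : ℝ}
    (h : m ≤ ENNReal.ofReal (Real.exp (p * b))) : ENNReal.log m / (p : EReal) ≤ (b : EReal) := by
  rw [EReal.div_le_iff_le_mul (by exact_mod_cast hp) (EReal.natCast_ne_top p)]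
  refine (ENNReal.log_le_log h).trans ?_
  rw [← EReal.exp_coe, EReal.log_exp]
  push_cast
  exact le_rfl

lemma le_log_div {m : ℝ≥0∞} {p : ℕ} (hp : 0 < p) {b : ℝ}
    (h : ENNReal.ofReal (Real.exp (p * b)) ≤ m) : (b : EReal) ≤ ENNReal.log m / (p : EReal) := by
  rw [EReal.le_div_iff_mul_le (by exact_mod_cast hp) (EReal.natCast_ne_top p)]
  refine le_trans ?_ (ENNReal.log_le_log h)
  rw [← EReal.exp_coe, EReal.log_exp]
  push_cast
  rw [mul_comm]

/-- Finitely many vectors control the norm from above. -/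
lemma exists_finset_norming (d : ℕ) : ∃ V : Finset (Space d), ∃ κ : ℝ, 0 < κ ∧
    ∀ y : Space d, y ≠ 0 → ∃ v ∈ V, κ * ‖y‖ ≤ inner ℝ v y := by
  obtain ⟨t, ht⟩ := (isCompact_sphere (0 : Space d) 1).elim_finite_subcover
    (fun v : Space d => {y | 1 / 2 < inner ℝ v y})
    (fun v => isOpen_lt continuous_const (by fun_prop)) (fun y hy => by
      refine Set.mem_iUnion.2 ⟨y, ?_⟩
      have : ‖y‖ = 1 := by simpa using hy
      simp only [Set.mem_ofPred_eq, real_inner_self_eq_norm_sq, this]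
      norm_num)
  refine ⟨t, 1 / 2, by norm_num, fun y hy => ?_⟩
  have hy' : 0 < ‖y‖ := norm_pos_iff.2 hy
  have hm : ‖y‖⁻¹ • y ∈ Metric.sphere (0 : Space d) 1 := by
    simp [norm_smul, hy'.ne']
  obtain ⟨v, hv, h⟩ := Set.mem_iUnion₂.1 (ht hm)
  refine ⟨v, hv, ?_⟩
  simp only [Set.mem_ofPred_eq, inner_smul_right] at h
  have := mul_lt_mul_of_pos_right h hy'
  rw [mul_comm (‖y‖⁻¹), mul_assoc, inv_mul_cancel₀ hy'.ne', mul_one] at this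
  exact this.le

lemma le_legendre (c : Space d → ℝ) (u x : Space d) :
    ((inner ℝ u x - c u : ℝ) : EReal) ≤ legendre c x :=
  le_iSup (fun u => ((inner ℝ u x - c u : ℝ) : EReal)) u

lemma legendre_nonneg {c : Space d → ℝ} (h0 : c 0 = 0) (x : Space d) : 0 ≤ legendre c x := by
  simpa [h0] using le_legendre c 0 x

lemma lowerSemicontinuous_legendre (c : Space d → ℝ) : LowerSemicontinuous (legendre c) := by
  refine lowerSemicontinuous_iSup fun u => Continuous.lowerSemicontinuous ?_
  exact continuous_coe_real_ereal.comp (by fun_prop)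

lemma isCompact_legendre_le (c : Space d → ℝ) (α : ℝ) :
    IsCompact {x | legendre c x ≤ (α : EReal)} := by
  obtain ⟨V, κ, hκ, hV⟩ := exists_finset_norming d
  refine Metric.isCompact_of_isClosed_isBounded
    ((lowerSemicontinuous_legendre c).isClosed_preimage _) ?_
  refine (isBounded_iff_forall_norm_le).2 ⟨(∑ v ∈ V, |α + c v|) / κ, fun x hx => ?_⟩
  by_cases hx0 : x = 0
  · rw [hx0, norm_zero]
    positivity
  obtain ⟨v, hv, h⟩ := hV x hx0
  have h1 : inner ℝ v x - c v ≤ α := EReal.coe_le_coe_iff.1 ((le_legendre c v x).trans hx)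
  rw [le_div_iff₀ hκ, mul_comm]
  calc κ * ‖x‖ ≤ inner ℝ v x := h
    _ ≤ |α + c v| := le_trans (by linarith) (le_abs_self _)
    _ ≤ ∑ v ∈ V, |α + c v| :=
      Finset.single_le_sum (f := fun v => |α + c v|) (fun _ _ => abs_nonneg _) hv

namespace HasScaledCumulantLimit

variable {μ : ℕ → Measure (Space d)} {c : Space d → ℝ} (H : HasScaledCumulantLimit μ c)
include H

lemma apply_zero : c 0 = 0 := by
  have := H.isProbabilityMeasure
  refine tendsto_nhds_unique (H.tendsto 0) ?_
  simp

lemma integral_pos (u : Space d) (p : ℕ) : 0 < ∫ x, Real.exp (p * inner ℝ u x) ∂μ p := by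
  have := H.isProbabilityMeasure p
  exact integral_exp_pos (H.integrable u p)

lemma eventually_integral_le (u : Space d) {η : ℝ} (hη : 0 < η) :
    ∀ᶠ p : ℕ in atTop, ∫ x, Real.exp (p * inner ℝ u x) ∂μ p ≤ Real.exp (p * (c u + η)) := by
  filter_upwards [(H.tendsto u).eventually (gt_mem_nhds (lt_add_of_pos_right (c u) hη)),
    eventually_gt_atTop 0] with p hp h0
  have h0' : (0 : ℝ) < p := by exact_mod_cast h0
  rw [← Real.log_le_iff_le_exp (H.integral_pos u p)]
  rw [one_div, inv_mul_lt_iff₀ h0'] at hp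
  exact hp.le

lemma eventually_le_integral (u : Space d) {η : ℝ} (hη : 0 < η) :
    ∀ᶠ p : ℕ in atTop, Real.exp (p * (c u - η)) ≤ ∫ x, Real.exp (p * inner ℝ u x) ∂μ p := by
  filter_upwards [(H.tendsto u).eventually (lt_mem_nhds (sub_lt_self (c u) hη)),
    eventually_gt_atTop 0] with p hp h0
  have h0' : (0 : ℝ) < p := by exact_mod_cast h0
  rw [← Real.le_log_iff_exp_le (H.integral_pos u p)]
  rw [one_div, lt_inv_mul_iff₀ h0'] at hp
  exact hp.le

/-- Chernoff's bound for a half-space under the measure of density `e^{p⟨u,·⟩}`. -/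
lemma eventually_setIntegral_halfspace_le (u v : Space d) {t : ℝ} (ht : 0 ≤ t) (a : ℝ) {η : ℝ}
    (hη : 0 < η) : ∀ᶠ p : ℕ in atTop,
      ∫ y in {y | a ≤ inner ℝ v y}, Real.exp (p * inner ℝ u y) ∂μ p
        ≤ Real.exp (p * (c (u + t • v) + η - t * a)) := by
  filter_upwards [H.eventually_integral_le (u + t • v) hη] with p hp
  have hms : MeasurableSet {y : Space d | a ≤ inner ℝ v y} :=
    measurableSet_le measurable_const (by fun_prop)
  calc ∫ y in {y | a ≤ inner ℝ v y}, Real.exp (p * inner ℝ u y) ∂μ p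
      ≤ ∫ y in {y | a ≤ inner ℝ v y},
          Real.exp (-(p * (t * a))) * Real.exp (p * inner ℝ (u + t • v) y) ∂μ p := by
        refine setIntegral_mono_on (H.integrable u p).integrableOn
          ((H.integrable _ p).const_mul _).integrableOn hms fun y hy => ?_
        rw [← Real.exp_add, Real.exp_le_exp, inner_add_left, real_inner_smul_left]
        have h1 : t * a ≤ t * inner ℝ v y := mul_le_mul_of_nonneg_left hy ht
        have h2 := mul_le_mul_of_nonneg_left h1 (Nat.cast_nonneg (α := ℝ) p)
        linarith
    _ ≤ ∫ y, Real.exp (-(p * (t * a))) * Real.exp (p * inner ℝ (u + t • v) y) ∂μ p :=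
        setIntegral_le_integral ((H.integrable _ p).const_mul _)
          (ae_of_all _ fun y => by positivity)
    _ ≤ Real.exp (-(p * (t * a))) * Real.exp (p * (c (u + t • v) + η)) := by
        rw [integral_const_mul]
        gcongr
    _ = Real.exp (p * (c (u + t • v) + η - t * a)) := by
        rw [← Real.exp_add]
        ring_nf

lemma eventually_halfspace_le (u : Space d) (a : ℝ) {η : ℝ} (hη : 0 < η) :
    ∀ᶠ p : ℕ in atTop, (μ p).real {y | a ≤ inner ℝ u y - c u} ≤ Real.exp (p * (η - a)) := by
  filter_upwards [H.eventually_setIntegral_halfspace_le 0 u zero_le_one (a + c u) hη] with p hp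
  have h : {y : Space d | a ≤ inner ℝ u y - c u} = {y | a + c u ≤ inner ℝ u y} := by
    ext y
    simp [le_sub_iff_add_le]
  rw [h]
  simp only [inner_zero_left, mul_zero, Real.exp_zero, setIntegral_const, smul_eq_mul, mul_one,
    zero_add, one_smul, one_mul] at hp
  convert hp using 3
  ring

omit H in
/-- A closed set on which the Legendre transform exceeds `α` is covered by finitely many
half-spaces of exponential cost at least `α`. The unbounded part is covered by half-spaces in the
directions of a finite norming set. -/
lemma exists_finset_halfspace_cover {F : Set (Space d)} (hF : IsClosed F) {α : ℝ}
    (hα : ∀ x ∈ F, (α : EReal) < legendre c x) :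
    ∃ T : Finset (Space d), ∀ y ∈ F, ∃ u ∈ T, α ≤ inner ℝ u y - c u := by
  classical
  obtain ⟨V, κ, hκ, hV⟩ := exists_finset_norming d
  -- outside the ball of radius `R` some half-space in a direction of `V` has cost at least `α`
  let R : ℝ := (∑ v ∈ V, |α + c v|) / κ
  have hR : 0 ≤ R := by positivity
  have hK : IsCompact (F ∩ Metric.closedBall 0 R) :=
    (isCompact_closedBall _ _).inter_left hF
  obtain ⟨T, hT⟩ := hK.elim_finite_subcover
    (fun u : Space d => {y | α < inner ℝ u y - c u})
    (fun v => isOpen_lt continuous_const (by fun_prop)) (fun y hy => by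
      obtain ⟨u, hu⟩ := lt_iSup_iff.1 (hα y hy.1)
      exact Set.mem_iUnion.2 ⟨u, EReal.coe_lt_coe_iff.1 hu⟩)
  refine ⟨T ∪ V, fun y hy => ?_⟩
  by_cases hyR : ‖y‖ ≤ R
  · obtain ⟨u, hu, h⟩ := Set.mem_iUnion₂.1 (hT ⟨hy, by simpa using hyR⟩)
    exact ⟨u, Finset.mem_union_left _ hu, le_of_lt h⟩
  · push Not at hyR
    obtain ⟨v, hv, h⟩ := hV y (norm_pos_iff.1 (hR.trans_lt hyR))
    refine ⟨v, Finset.mem_union_right _ hv, ?_⟩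
    have h1 : |α + c v| ≤ ∑ v ∈ V, |α + c v| :=
      Finset.single_le_sum (f := fun v => |α + c v|) (fun _ _ => abs_nonneg _) hv
    have h2 : ∑ v ∈ V, |α + c v| < κ * ‖y‖ := by
      rwa [div_lt_iff₀ hκ, mul_comm] at hyR
    linarith [le_abs_self (α + c v)]

lemma upper {F : Set (Space d)} (hF : IsClosed F) :
    limsup (fun p : ℕ => ENNReal.log (μ p F) / (p : EReal)) atTop
      ≤ -(⨅ x ∈ F, legendre c x) := by
  have := H.isProbabilityMeasure
  refine EReal.le_of_forall_lt_iff_le.1 fun z hz => ?_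
  obtain ⟨z', hz', hz'z⟩ := EReal.lt_iff_exists_real_btwn.1 hz
  rw [EReal.coe_lt_coe_iff] at hz'z
  have hα : ∀ x ∈ F, ((-z' : ℝ) : EReal) < legendre c x := fun x hx => by
    rw [EReal.coe_neg, EReal.neg_lt_comm]
    refine lt_of_le_of_lt ?_ hz'
    exact EReal.neg_le_neg_iff.2 (iInf₂_le x hx)
  obtain ⟨T, hT⟩ := exists_finset_halfspace_cover hF hα
  obtain ⟨η, hη, hηz⟩ : ∃ η, 0 < η ∧ z' + 2 * η ≤ z := ⟨(z - z') / 2, by linarith, by linarith⟩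
  have hbound : ∀ᶠ p : ℕ in atTop, (T.card : ℝ) ≤ Real.exp (p * η) :=
    ((Real.tendsto_exp_atTop.comp (tendsto_natCast_atTop_atTop.atTop_mul_const hη)
      ).eventually_ge_atTop _)
  have hall : ∀ᶠ p : ℕ in atTop, ∀ u ∈ T,
      (μ p).real {y | -z' ≤ inner ℝ u y - c u} ≤ Real.exp (p * (η - -z')) :=
    (Finset.eventually_all T).2 fun u _ => H.eventually_halfspace_le u (-z') hη
  refine limsup_le_of_le (h := ?_)
  filter_upwards [hbound, hall, eventually_gt_atTop 0] with p hp1 hp2 hp0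
  refine log_div_le hp0 ?_
  rw [← ofReal_measureReal]
  refine ENNReal.ofReal_le_ofReal ?_
  calc (μ p).real F ≤ (μ p).real (⋃ u ∈ T, {y | -z' ≤ inner ℝ u y - c u}) := by
        refine measureReal_mono (fun y hy => ?_) (measure_ne_top _ _)
        obtain ⟨u, hu, h⟩ := hT y hy
        exact Set.mem_iUnion₂.2 ⟨u, hu, h⟩
    _ ≤ ∑ u ∈ T, (μ p).real {y | -z' ≤ inner ℝ u y - c u} := measureReal_biUnion_finset_le _ _
    _ ≤ ∑ u ∈ T, Real.exp (p * (η - -z')) := Finset.sum_le_sum hp2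
    _ = T.card * Real.exp (p * (η - -z')) := by simp
    _ ≤ Real.exp (p * η) * Real.exp (p * (η - -z')) := by gcongr
    _ = Real.exp (p * (z' + 2 * η)) := by rw [← Real.exp_add]; ring_nf
    _ ≤ Real.exp (p * z) := by gcongr

/-- If `c` has gradient `m` at `u`, the measures of density `e^{p⟨u,·⟩}` concentrate at `m`, whence
a lower bound on the mass that `μ_p` gives to a ball around `m`. -/
lemma eventually_le_measure_ball {u m : Space d}
    (hm : ∀ v, HasDerivAt (fun t : ℝ => c (u + t • v)) (inner ℝ v m) 0) {δ : ℝ} (hδ : 0 < δ)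
    {η : ℝ} (hη : 0 < η) : ∀ᶠ p : ℕ in atTop,
      Real.exp (p * (c u - inner ℝ u m - ‖u‖ * δ - η)) ≤ (μ p).real (Metric.ball m δ) := by
  have := H.isProbabilityMeasure
  obtain ⟨V, κ, hκ, hV⟩ := exists_finset_norming d
  have hκδ : 0 < κ * δ := mul_pos hκ hδ
  -- a step `t` so short that `c (u + t v)` is within `t κ δ / 2` of its linear approximation
  obtain ⟨t, ht, htV⟩ : ∃ t : ℝ, 0 < t ∧ ∀ v ∈ V,
      c (u + t • v) ≤ c u + t * inner ℝ v m + t * (κ * δ / 2) := by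
    have h1 : ∀ v ∈ V, ∀ᶠ t : ℝ in 𝓝[>] 0,
        c (u + t • v) ≤ c u + t * inner ℝ v m + t * (κ * δ / 2) := by
      intro v _
      have h2 := ((hasDerivAt_iff_isLittleO.1 (hm v)).def (half_pos hκδ))
      filter_upwards [nhdsWithin_le_nhds h2, self_mem_nhdsWithin] with t ht ht0
      have ht0' : (0 : ℝ) < t := ht0
      simp only [zero_smul, add_zero, sub_zero, smul_eq_mul, Real.norm_eq_abs,
        abs_of_pos ht0'] at ht
      linarith [le_abs_self (c (u + t • v) - c u - t * inner ℝ v m)]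
    have h3 := ((Finset.eventually_all V).2 h1).and self_mem_nhdsWithin
    obtain ⟨t, ht, ht0⟩ := h3.exists
    exact ⟨t, ht0, ht⟩
  -- `θ` is both the precision of the exponential estimates and the gap that makes the mass outside
  -- the ball, at most `|V| e^{p (c(u) - 3θ)}`, negligible against the total mass
  obtain ⟨θ, hθ, hθη, hθt⟩ : ∃ θ, 0 < θ ∧ 2 * θ ≤ η ∧ 4 * θ ≤ t * (κ * δ / 2) := by
    have h : 0 < t * (κ * δ / 2) := by positivity
    refine ⟨min (η / 2) (t * (κ * δ / 2) / 4), by positivity, ?_, ?_⟩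
    · linarith [min_le_left (η / 2) (t * (κ * δ / 2) / 4)]
    · linarith [min_le_right (η / 2) (t * (κ * δ / 2) / 4)]
  have hbound : ∀ᶠ p : ℕ in atTop, (2 * V.card + 2 : ℝ) ≤ Real.exp (p * θ) :=
    ((Real.tendsto_exp_atTop.comp (tendsto_natCast_atTop_atTop.atTop_mul_const hθ)
      ).eventually_ge_atTop _)
  have hall : ∀ᶠ p : ℕ in atTop, ∀ v ∈ V,
      ∫ y in {y | inner ℝ v m + κ * δ ≤ inner ℝ v y}, Real.exp (p * inner ℝ u y) ∂μ p
        ≤ Real.exp (p * (c u - 3 * θ)) := by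
    refine (Finset.eventually_all V).2 fun v hv => ?_
    filter_upwards [H.eventually_setIntegral_halfspace_le u v ht.le (inner ℝ v m + κ * δ) hθ]
      with p hp
    refine hp.trans (Real.exp_le_exp.2 (mul_le_mul_of_nonneg_left ?_ (Nat.cast_nonneg p)))
    linarith [htV v hv]
  filter_upwards [hbound, hall, H.eventually_le_integral u hθ] with p hp1 hp2 hp3
  set f : Space d → ℝ := fun y => Real.exp (p * inner ℝ u y) with hf
  have hfi : Integrable f (μ p) := H.integrable u p
  have hcompl : ∫ y in (Metric.ball m δ)ᶜ, f y ∂μ p ≤ V.card * Real.exp (p * (c u - 3 * θ)) := by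
    calc ∫ y in (Metric.ball m δ)ᶜ, f y ∂μ p
        ≤ ∫ y in ⋃ v ∈ V, {y | inner ℝ v m + κ * δ ≤ inner ℝ v y}, f y ∂μ p := by
          refine setIntegral_mono_set hfi.integrableOn (ae_of_all _ fun y => by positivity)
            (LE.le.eventuallyLE fun y hy => ?_)
          have hy' : δ ≤ ‖y - m‖ := by
            simpa [dist_eq_norm] using hy
          obtain ⟨v, hv, h⟩ := hV (y - m) (norm_pos_iff.1 (hδ.trans_le hy'))
          refine Set.mem_iUnion₂.2 ⟨v, hv, ?_⟩
          rw [inner_sub_right] at h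
          have := mul_le_mul_of_nonneg_left hy' hκ.le
          simp only [Set.mem_ofPred_eq]
          linarith
      _ ≤ ∑ v ∈ V, ∫ y in {y | inner ℝ v m + κ * δ ≤ inner ℝ v y}, f y ∂μ p := by
          have h := measure_biUnion_finset_le (μ := (μ p).withDensity fun y => ENNReal.ofReal (f y))
            V (fun v => {y : Space d | inner ℝ v m + κ * δ ≤ inner ℝ v y})
          have hS : ∀ s : Set (Space d), ∫⁻ y in s, ENNReal.ofReal (f y) ∂μ p
              = ENNReal.ofReal (∫ y in s, f y ∂μ p) := fun s =>
            (ofReal_integral_eq_lintegral_ofReal hfi.integrableOn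
              (ae_of_all _ fun y => by positivity)).symm
          simp only [withDensity_apply', hS] at h
          rw [← ENNReal.ofReal_sum_of_nonneg fun v _ =>
            integral_nonneg fun y => by positivity] at h
          exact (ENNReal.ofReal_le_ofReal_iff (Finset.sum_nonneg fun v _ =>
            integral_nonneg fun y => by positivity)).1 h
      _ ≤ ∑ v ∈ V, Real.exp (p * (c u - 3 * θ)) := Finset.sum_le_sum hp2
      _ = V.card * Real.exp (p * (c u - 3 * θ)) := by simp
  have hball : ∫ y in Metric.ball m δ, f y ∂μ p
      ≤ Real.exp (p * (inner ℝ u m + ‖u‖ * δ)) * (μ p).real (Metric.ball m δ) := by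
    calc ∫ y in Metric.ball m δ, f y ∂μ p
        ≤ ∫ y in Metric.ball m δ, Real.exp (p * (inner ℝ u m + ‖u‖ * δ)) ∂μ p := by
          refine setIntegral_mono_on hfi.integrableOn (integrable_const _).integrableOn
            measurableSet_ball fun y hy => ?_
          refine Real.exp_le_exp.2 (mul_le_mul_of_nonneg_left ?_ (Nat.cast_nonneg p))
          have h1 : inner ℝ u (y - m) ≤ ‖u‖ * ‖y - m‖ := real_inner_le_norm _ _
          have h2 : ‖y - m‖ ≤ δ := by
            rw [← dist_eq_norm]
            exact (Metric.mem_ball.1 hy).le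
          rw [inner_sub_right] at h1
          linarith [mul_le_mul_of_nonneg_left h2 (norm_nonneg u)]
      _ = _ := by simp [mul_comm]
  have hsum := integral_add_compl (measurableSet_ball (x := m) (ε := δ)) hfi
  have hE1 : Real.exp (p * (c u - θ)) = Real.exp (p * θ) * Real.exp (p * (c u - 2 * θ)) := by
    rw [← Real.exp_add]; ring_nf
  have hE2 : Real.exp (p * (c u - 3 * θ)) ≤ Real.exp (p * (c u - 2 * θ)) :=
    Real.exp_le_exp.2 (mul_le_mul_of_nonneg_left (by linarith) (Nat.cast_nonneg p))
  have hpos := Real.exp_pos (p * (c u - 2 * θ))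
  have hmain : Real.exp (p * (c u - 2 * θ)) ≤ ∫ y in Metric.ball m δ, f y ∂μ p := by
    have h1 : (2 * V.card + 2) * Real.exp (p * (c u - 2 * θ)) ≤ ∫ y, f y ∂μ p := by
      refine le_trans ?_ hp3
      rw [hE1]
      gcongr
    have h2 : V.card * Real.exp (p * (c u - 3 * θ)) ≤ V.card * Real.exp (p * (c u - 2 * θ)) := by
      gcongr
    have h3 : 0 ≤ V.card * Real.exp (p * (c u - 2 * θ)) := by positivity
    linarith
  have hfin := hmain.trans hball
  calc Real.exp (p * (c u - inner ℝ u m - ‖u‖ * δ - η))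
      ≤ Real.exp (-(p * (inner ℝ u m + ‖u‖ * δ))) * Real.exp (p * (c u - 2 * θ)) := by
        rw [← Real.exp_add, Real.exp_le_exp]
        have := mul_le_mul_of_nonneg_left hθη (Nat.cast_nonneg (α := ℝ) p)
        linarith
    _ ≤ Real.exp (-(p * (inner ℝ u m + ‖u‖ * δ))) *
          (Real.exp (p * (inner ℝ u m + ‖u‖ * δ)) * (μ p).real (Metric.ball m δ)) := by gcongr
    _ = _ := by rw [← mul_assoc, ← Real.exp_add, neg_add_cancel, Real.exp_zero, one_mul]

omit H in
/-- Points of finite rate are limits of gradients of `c` of no larger rate: the maximiser `u` of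
`⟨u, x⟩ - c(u) - ε‖u‖² / 2` exists by coercivity, has gradient `x - ε u`, and `ε‖u‖` is of order
`√ε` because the maximum is nonnegative. -/
lemma exists_gradient_near (h0 : c 0 = 0) (hc : Continuous c)
    (hdiff : ∀ u v, DifferentiableAt ℝ (fun t : ℝ => c (u + t • v)) 0) {x : Space d} {b : ℝ}
    (hx : ∀ u, inner ℝ u x - c u ≤ b) {δ : ℝ} (hδ : 0 < δ) :
    ∃ u m : Space d, (∀ v, HasDerivAt (fun t : ℝ => c (u + t • v)) (inner ℝ v m) 0) ∧
      ‖m - x‖ < δ ∧ inner ℝ u m - c u ≤ b := by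
  have hb : 0 ≤ b := by simpa [h0] using hx 0
  obtain ⟨ε, hε, hεδ⟩ : ∃ ε : ℝ, 0 < ε ∧ 2 * ε * b < δ ^ 2 := by
    refine ⟨δ ^ 2 / (2 * b + 1) / 2, by positivity, ?_⟩
    have h : δ ^ 2 / (2 * b + 1) * (2 * b + 1) = δ ^ 2 := div_mul_cancel₀ _ (by positivity)
    have h' : 0 < δ ^ 2 / (2 * b + 1) := by positivity
    nlinarith
  let f : Space d → ℝ := fun u => inner ℝ u x - c u - ε / 2 * ‖u‖ ^ 2
  have hf : Continuous f := by fun_prop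
  have hcoer : Tendsto f (cocompact (Space d)) atBot := by
    have h1 : Tendsto (fun u : Space d => b - ε / 2 * ‖u‖ ^ 2) (cocompact (Space d)) atBot := by
      refine tendsto_atBot_add_const_left _ b (tendsto_neg_atTop_atBot.comp ?_)
      exact ((tendsto_pow_atTop two_ne_zero).comp
        (tendsto_norm_cocompact_atTop (E := Space d))).const_mul_atTop (half_pos hε)
    exact tendsto_atBot_mono (fun u => sub_le_sub_right (hx u) _) h1
  obtain ⟨u, hu⟩ := hf.exists_forall_ge hcoer
  have hu0 : ε / 2 * ‖u‖ ^ 2 ≤ b := by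
    have h1 := hu 0
    simp only [f, inner_zero_left, h0, norm_zero] at h1
    nlinarith [hx u]
  refine ⟨u, x - ε • u, fun v => ?_, ?_, ?_⟩
  · have hd := (hdiff u v).hasDerivAt
    have h1 : HasDerivAt (fun t : ℝ => f (u + t • v))
        (inner ℝ v x - deriv (fun t : ℝ => c (u + t • v)) 0 - ε * inner ℝ v u) 0 := by
      have hline : HasDerivAt (fun t : ℝ => u + t • v) v 0 := by
        simpa using ((hasDerivAt_id (0 : ℝ)).smul_const v).const_add u
      have hi : HasDerivAt (fun t : ℝ => inner ℝ (u + t • v) x) (inner ℝ v x) 0 := by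
        simpa using hline.inner ℝ (hasDerivAt_const (0 : ℝ) x)
      have hn : HasDerivAt (fun t : ℝ => ε / 2 * ‖u + t • v‖ ^ 2) (ε * inner ℝ v u) 0 := by
        have h := (hline.norm_sq).const_mul (ε / 2)
        have h' : ε / 2 * (2 * inner ℝ (u + (0 : ℝ) • v) v) = ε * inner ℝ v u := by
          rw [zero_smul, add_zero, real_inner_comm]
          ring
        rwa [h'] at h
      exact (hi.sub hd).sub hn
    have h2 : IsLocalMax (fun t : ℝ => f (u + t • v)) 0 :=
      Filter.Eventually.of_forall fun t => by simpa using hu (u + t • v)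
    have h3 := h2.hasDerivAt_eq_zero h1
    have h4 : inner ℝ v (x - ε • u) = deriv (fun t : ℝ => c (u + t • v)) 0 := by
      rw [inner_sub_right, real_inner_smul_right]
      linarith
    rw [h4]
    exact hd
  · rw [sub_sub_cancel_left, norm_neg, norm_smul, Real.norm_of_nonneg hε.le]
    refine lt_of_pow_lt_pow_left₀ 2 hδ.le (lt_of_le_of_lt ?_ hεδ)
    nlinarith
  · rw [inner_sub_right, real_inner_smul_right, real_inner_self_eq_norm_sq]
    nlinarith [hx u, sq_nonneg ‖u‖]

lemma lower (hc : Continuous c)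
    (hdiff : ∀ u v, DifferentiableAt ℝ (fun t : ℝ => c (u + t • v)) 0) {G : Set (Space d)}
    (hG : IsOpen G) :
    -(⨅ x ∈ G, legendre c x)
      ≤ liminf (fun p : ℕ => ENNReal.log (μ p G) / (p : EReal)) atTop := by
  have := H.isProbabilityMeasure
  rw [EReal.neg_le]
  refine le_iInf₂ fun x hx => ?_
  rw [EReal.neg_le]
  refine EReal.ge_of_forall_gt_iff_ge.1 fun z hz => ?_
  obtain ⟨b, hb, hbz⟩ : ∃ b : ℝ, (∀ u, inner ℝ u x - c u ≤ b) ∧ b < -z := by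
    rw [EReal.lt_neg_comm] at hz
    obtain ⟨b, hb1, hb2⟩ := EReal.lt_iff_exists_real_btwn.1 hz
    refine ⟨b, fun u => EReal.coe_le_coe_iff.1 ((le_legendre c u x).trans hb1.le), ?_⟩
    rw [← EReal.coe_neg] at hb2
    exact EReal.coe_lt_coe_iff.1 hb2
  obtain ⟨r, hr, hrG⟩ := Metric.isOpen_iff.1 hG x hx
  obtain ⟨u, m, hm, hmx, hum⟩ :=
    exists_gradient_near H.apply_zero hc hdiff hb (half_pos hr)
  obtain ⟨δ, hδ, hδr, hδz⟩ : ∃ δ : ℝ, 0 < δ ∧ δ ≤ r / 2 ∧ ‖u‖ * δ ≤ (-z - b) / 2 := by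
    have hzb : 0 < -z - b := by linarith
    refine ⟨min (r / 2) ((-z - b) / 2 / (‖u‖ + 1)), by positivity, min_le_left _ _, ?_⟩
    calc ‖u‖ * min (r / 2) ((-z - b) / 2 / (‖u‖ + 1))
        ≤ (‖u‖ + 1) * ((-z - b) / 2 / (‖u‖ + 1)) := by
          gcongr
          · linarith
          · exact min_le_right _ _
      _ = (-z - b) / 2 := mul_div_cancel₀ _ (by positivity)
  refine le_liminf_of_le (h := ?_)
  filter_upwards [H.eventually_le_measure_ball hm hδ (η := (-z - b) / 2) (by linarith),
    eventually_gt_atTop 0] with p hp hp0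
  refine le_log_div hp0 ?_
  rw [← ofReal_measureReal]
  refine ENNReal.ofReal_le_ofReal ?_
  calc Real.exp (p * z) ≤ Real.exp (p * (c u - inner ℝ u m - ‖u‖ * δ - (-z - b) / 2)) := by
        refine Real.exp_le_exp.2 (mul_le_mul_of_nonneg_left ?_ (Nat.cast_nonneg p))
        linarith
    _ ≤ (μ p).real (Metric.ball m δ) := hp
    _ ≤ (μ p).real G := by
        refine measureReal_mono ((Metric.ball_subset_ball' ?_).trans hrG)
        rw [dist_eq_norm]
        linarith

/-- The **Gärtner–Ellis theorem** for a limit that is finite, continuous and differentiable along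
lines. -/
theorem isFullLDP (hc : Continuous c)
    (hdiff : ∀ u v, DifferentiableAt ℝ (fun t : ℝ => c (u + t • v)) 0) :
    IsFullLDP μ (legendre c) where
  nonneg := legendre_nonneg H.apply_zero
  lowerSemicontinuous := lowerSemicontinuous_legendre c
  isCompact_level := isCompact_legendre_le c
  lower _ hG := H.lower hc hdiff hG
  upper _ hF := H.upper hF

end HasScaledCumulantLimit

end GartnerEllis

/-! ### Cyclic resolutions in dimension two -/

lemma one_le_trace_re_of_isHermitian_of_idempotent {P : Op} (hP : P.IsHermitian)
    (hPP : P * P = P) (h0 : P ≠ 0) : 1 ≤ P.trace.re := by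
  have h00 := congrFun₂ hPP 0 0
  have h11 := congrFun₂ hPP 1 1
  have h01 := congrFun₂ hPP 0 1
  have hb : P 1 0 = star (P 0 1) := (hP.apply 0 1 ▸ (star_star _).symm)
  have ha : (P 0 0).im = 0 := Complex.conj_eq_iff_im.1 (hP.apply 0 0)
  have hd : (P 1 1).im = 0 := Complex.conj_eq_iff_im.1 (hP.apply 1 1)
  simp only [Matrix.mul_apply, Fin.sum_univ_two, hb] at h00 h11 h01
  have r00 := congrArg Complex.re h00
  have r11 := congrArg Complex.re h11
  have r01 := congrArg Complex.re h01
  have i01 := congrArg Complex.im h01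
  simp only [Complex.add_re, Complex.add_im, Complex.mul_re, Complex.mul_im, ha, hd,
    Complex.star_def, Complex.conj_re, Complex.conj_im] at r00 r11 r01 i01
  rw [Matrix.trace_fin_two, Complex.add_re]
  set a := (P 0 0).re
  set d := (P 1 1).re
  set x := (P 0 1).re with hx
  set y := (P 0 1).im with hy
  by_contra hlt
  push Not at hlt
  have ha0 : 0 ≤ a := by nlinarith [sq_nonneg a, sq_nonneg x, sq_nonneg y]
  have hd0 : 0 ≤ d := by nlinarith [sq_nonneg d, sq_nonneg x, sq_nonneg y]
  have hx0 : x = 0 := by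
    have : x * (a + d - 1) = 0 := by linarith
    rcases mul_eq_zero.1 this with h | h
    · exact h
    · linarith
  have hy0 : y = 0 := by
    have : y * (a + d - 1) = 0 := by linarith
    rcases mul_eq_zero.1 this with h | h
    · exact h
    · linarith
  have ha' : a = 0 := by
    have : a * (a - 1) = 0 := by rw [hx0, hy0] at r00; linarith
    rcases mul_eq_zero.1 this with h | h
    · exact h
    · linarith
  have hd' : d = 0 := by
    have : d * (d - 1) = 0 := by rw [hx0, hy0] at r11; linarith
    rcases mul_eq_zero.1 this with h | h
    · exact h
    · linarith
  have e01 : P 0 1 = 0 := Complex.ext hx0 hy0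
  refine h0 (Matrix.ext fun i j => ?_)
  fin_cases i <;> fin_cases j
  · exact Complex.ext ha' ha
  · exact e01
  · change P 1 0 = 0
    rw [hb, e01, star_zero]
  · exact Complex.ext hd' hd

namespace OQRW

variable {d : ℕ} {W : OQRW d}

lemma H1.eq_zero_of_mul_L (h1 : W.H1) {X : Op} (hX : ∀ s, X * W.L s = 0) : X = 0 := by
  have h : (⊤ : Submodule ℂ (Fin 2 → ℂ)) ≤ LinearMap.ker (Matrix.toLin' X) := by
    rw [← h1]
    refine iSup₂_le fun s _ => ?_
    rintro _ ⟨x, rfl⟩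
    rw [LinearMap.mem_ker, ← Matrix.toLin'_mul_apply, hX, map_zero, LinearMap.zero_apply]
  have h' := LinearMap.ker_eq_top.1 (top_le_iff.1 h)
  exact (Matrix.toLin' (R := ℂ)).map_eq_zero_iff.1 h'

open Fin.CommRing in
/-- The projections of a cyclic resolution are nonzero, as one zero projection would make all of
them vanish. -/
lemma H1.cyclicResolution_ne_zero (h1 : W.H1) {n : ℕ} {P : Fin (n + 1) → Op}
    (hP : IsCyclicResolution W.L n P) (j : Fin (n + 1)) : P j ≠ 0 := by
  intro hj
  have hstep : ∀ k, P k = 0 → P (k + 1) = 0 := fun k hk =>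
    h1.eq_zero_of_mul_L fun s => by rw [hP.cyclic, add_sub_cancel_right, hk, mul_zero]
  have hall : ∀ m : ℕ, P (j + (m : Fin (n + 1))) = 0 := by
    intro m
    induction m with
    | zero => simpa using hj
    | succ m ih => rw [Nat.cast_succ, ← add_assoc]; exact hstep _ ih
  have hzero : ∀ k, P k = 0 := fun k => by
    simpa using hall (k - j : Fin (n + 1)).val
  have hsum := hP.sum_eq_one
  simp only [hzero, Finset.sum_const_zero] at hsum
  exact zero_ne_one hsum

/-- Two is the largest length of a cyclic resolution, because the projections have trace at
least one. -/
lemma H1.cyclicResolution_le_one (h1 : W.H1) {n : ℕ} {P : Fin (n + 1) → Op}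
    (hP : IsCyclicResolution W.L n P) : n ≤ 1 := by
  have h2 : ∑ j, (P j).trace.re = 2 := by
    rw [← Complex.re_sum, ← Matrix.trace_sum, hP.sum_eq_one]
    simp
  have h3 : ∑ _j : Fin (n + 1), (1 : ℝ) ≤ ∑ j, (P j).trace.re :=
    Finset.sum_le_sum fun j _ => one_le_trace_re_of_isHermitian_of_idempotent
      (hP.isHermitian j) (hP.idempotent j) (h1.cyclicResolution_ne_zero hP j)
  rw [h2] at h3
  simp only [Finset.sum_const, Finset.card_univ, Fintype.card_fin, nsmul_eq_mul, mul_one] at h3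
  have h4 : n + 1 ≤ 2 := by exact_mod_cast h3
  omega

/-- In a basis diagonalising `P₀`, the relation `P₀ Lₛ = Lₛ (1 - P₀)` reads
`λᵢ mᵢⱼ = mᵢⱼ (1 - λⱼ)` with `λᵢ ∈ {0, 1}`, and forces `mᵢᵢ = 0`. -/
theorem H1.exists_isAntidiagonalIn (h1 : W.H1) (hper : IsPeriodic W.L) :
    ∃ (U : Matrix.unitaryGroup (Fin 2) ℂ) (ν γ : Lattice d → ℂ), W.IsAntidiagonalIn U ν γ := by
  obtain ⟨n, hn⟩ := lt_iSup_iff.1 hper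
  obtain ⟨⟨P, hP⟩, hn⟩ := lt_iSup_iff.1 hn
  have hn1 : 1 < n + 1 := by exact_mod_cast hn
  obtain rfl : n = 1 := le_antisymm (h1.cyclicResolution_le_one hP) (by omega)
  have hH := hP.isHermitian 0
  have hsum : P 1 = 1 - P 0 := by
    have := hP.sum_eq_one
    rw [Fin.sum_univ_two] at this
    exact eq_sub_of_add_eq' this
  let U : Matrix.unitaryGroup (Fin 2) ℂ := hH.eigenvectorUnitary
  have hU1 : (U : Op)ᴴ * (U : Op) = 1 := Unitary.coe_star_mul_self U
  have hU2 : (U : Op) * (U : Op)ᴴ = 1 := Unitary.coe_mul_star_self U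
  let D : Op := Matrix.diagonal (RCLike.ofReal ∘ hH.eigenvalues)
  have hPD : P 0 = U * D * (U : Op)ᴴ := by
    conv_lhs => rw [hH.spectral_theorem]
    rfl
  have hD : D = (U : Op)ᴴ * P 0 * U := by
    rw [hPD]
    simp only [Matrix.mul_assoc, hU1, Matrix.mul_one]
    rw [← Matrix.mul_assoc, hU1, Matrix.one_mul]
  have hDD : D * D = D := by
    calc D * D = (U : Op)ᴴ * (P 0 * ((U : Op) * (U : Op)ᴴ) * P 0) * U := by
          rw [hD]; simp only [Matrix.mul_assoc]
      _ = D := by rw [hU2, Matrix.mul_one, hP.idempotent, hD]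
  have key : ∀ s i, ((U : Op)ᴴ * W.L s * (U : Op)) i i = 0 := by
    intro s i
    set M := (U : Op)ᴴ * W.L s * (U : Op) with hM
    have hc : D * M = M - M * D := by
      have hcyc : P 0 * W.L s = W.L s * (1 - P 0) := by
        rw [← hsum]
        exact hP.cyclic 0 s
      calc D * M = (U : Op)ᴴ * (P 0 * ((U : Op) * (U : Op)ᴴ) * W.L s) * U := by
            rw [hD]; simp only [hM, Matrix.mul_assoc]
        _ = (U : Op)ᴴ * (W.L s * (1 - P 0)) * U := by rw [hU2, Matrix.mul_one, hcyc]
        _ = M - (U : Op)ᴴ * (W.L s * P 0) * U := by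
            rw [Matrix.mul_sub, Matrix.mul_one, Matrix.mul_sub, Matrix.sub_mul]
        _ = M - (U : Op)ᴴ * (W.L s * ((U : Op) * (U : Op)ᴴ) * P 0) * U := by
            rw [hU2, Matrix.mul_one]
        _ = M - M * D := by rw [hD]; simp only [hM, Matrix.mul_assoc]
    have h2 := congrFun₂ hc i i
    have h3 := congrFun₂ hDD i i
    simp only [D, Matrix.sub_apply, Matrix.diagonal_mul, Matrix.mul_diagonal,
      Matrix.diagonal_apply_eq] at h2 h3
    set l : ℂ := (RCLike.ofReal ∘ hH.eigenvalues) i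
    have h4 : l * (l - 1) = 0 := by linear_combination h3
    rcases mul_eq_zero.1 h4 with h | h
    · rw [h] at h2
      simpa using h2.symm
    · rw [sub_eq_zero.1 h] at h2
      simpa using h2
  refine ⟨U, fun s => ((U : Op)ᴴ * W.L s * (U : Op)) 1 0,
    fun s => ((U : Op)ᴴ * W.L s * (U : Op)) 0 1, fun s => Matrix.ext fun i j => ?_⟩
  fin_cases i <;> fin_cases j
  · exact key s 0
  · rfl
  · rfl
  · exact key s 1

end OQRW

/-! ### The step laws and the deformed maps in an antidiagonal basis -/

/-- The moment generating function `u ↦ E e^{⟨u, A⟩}` of a step `A` with `P(A = s) = |aₛ|²`. -/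
def stepMGF {d : ℕ} (a : Lattice d → ℂ) (u : Space d) : ℝ :=
  ∫ s, Real.exp (pairing u s) ∂stepLaw a

section StepLaw

variable {d : ℕ} {a : Lattice d → ℂ}

lemma stepLaw_univ_eq_one (h : HasSum (fun s => ‖a s‖ ^ 2) 1) : stepLaw a Set.univ = 1 := by
  rw [stepLaw, Measure.sum_apply _ MeasurableSet.univ]
  simp only [Measure.smul_apply, measure_univ, smul_eq_mul, mul_one]
  rw [← ENNReal.ofReal_tsum_of_nonneg (fun s => by positivity) h.summable, h.tsum_eq,
    ENNReal.ofReal_one]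

lemma integrable_stepLaw_iff {f : Lattice d → ℝ} :
    Integrable f (stepLaw a) ↔ Summable fun s => ‖a s‖ ^ 2 * ‖f s‖ := by
  rw [stepLaw, integrable_sum_dirac_iff (fun _ => ENNReal.ofReal_ne_top)]
  simp

lemma hasSum_integral_stepLaw {f : Lattice d → ℝ} (hf : Integrable f (stepLaw a)) :
    HasSum (fun s => ‖a s‖ ^ 2 * f s) (∫ s, f s ∂stepLaw a) := by
  have h := hasSum_integral_sum_dirac (f := f) (x := fun s : Lattice d => s)
    (c := fun s => ENNReal.ofReal (‖a s‖ ^ 2)) (fun _ => ENNReal.ofReal_ne_top)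
    (by simpa using integrable_stepLaw_iff.1 hf)
  simp only [ENNReal.toReal_ofReal (sq_nonneg _), smul_eq_mul] at h
  exact h

end StepLaw

namespace OQRW

variable {d : ℕ} {W : OQRW d} {U : Matrix.unitaryGroup (Fin 2) ℂ} {ν γ : Lattice d → ℂ}

namespace IsAntidiagonalIn

lemma L_eq (h : W.IsAntidiagonalIn U ν γ) (s : Lattice d) :
    W.L s = U * !![0, γ s; ν s, 0] * (U : Op)ᴴ := by
  have hU2 : (U : Op) * (U : Op)ᴴ = 1 := Unitary.coe_mul_star_self U
  rw [← h s]
  calc W.L s = ((U : Op) * (U : Op)ᴴ) * W.L s * ((U : Op) * (U : Op)ᴴ) := by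
        rw [hU2, Matrix.one_mul, Matrix.mul_one]
    _ = _ := by simp only [Matrix.mul_assoc]

lemma conj_star_mul_self (h : W.IsAntidiagonalIn U ν γ) (s : Lattice d) :
    (U : Op)ᴴ * ((W.L s)ᴴ * W.L s) * U
      = !![((‖ν s‖ ^ 2 : ℝ) : ℂ), 0; 0, ((‖γ s‖ ^ 2 : ℝ) : ℂ)] := by
  have hU2 : (U : Op) * (U : Op)ᴴ = 1 := Unitary.coe_mul_star_self U
  calc (U : Op)ᴴ * ((W.L s)ᴴ * W.L s) * U
      = (U : Op)ᴴ * ((W.L s)ᴴ * ((U : Op) * (U : Op)ᴴ) * W.L s) * U := by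
        rw [hU2, Matrix.mul_one]
    _ = ((U : Op)ᴴ * W.L s * (U : Op))ᴴ * ((U : Op)ᴴ * W.L s * (U : Op)) := by
        simp only [Matrix.conjTranspose_mul, Matrix.conjTranspose_conjTranspose, Matrix.mul_assoc]
    _ = _ := by
        rw [h s]
        ext i j
        fin_cases i <;> fin_cases j <;>
          simp [Matrix.mul_apply, Fin.sum_univ_two, Complex.conj_mul']

/-- Summing scalar multiples of `Lₛ* Lₛ`, read in the antidiagonal basis. -/
lemma hasSum_diag (h : W.IsAntidiagonalIn U ν γ) {r : Lattice d → ℝ} {X : Op}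
    (hr : HasSum (fun s => r s • ((W.L s)ᴴ * W.L s)) X) :
    HasSum (fun s => ‖ν s‖ ^ 2 * r s) (((U : Op)ᴴ * X * U) 0 0).re ∧
      HasSum (fun s => ‖γ s‖ ^ 2 * r s) (((U : Op)ᴴ * X * U) 1 1).re := by
  have h1 : HasSum (fun s => (U : Op)ᴴ * (r s • ((W.L s)ᴴ * W.L s)) * U) ((U : Op)ᴴ * X * U) :=
    hr.map ((AddMonoidHom.mulRight (U : Op)).comp (AddMonoidHom.mulLeft (U : Op)ᴴ))
      ((continuous_const.matrix_mul continuous_id).matrix_mul continuous_const)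
  have h2 : ∀ i, HasSum (fun s => (((U : Op)ᴴ * (r s • ((W.L s)ᴴ * W.L s)) * U) i i).re)
      (((U : Op)ᴴ * X * U) i i).re := fun i =>
    Complex.hasSum_re (Pi.hasSum.1 (Pi.hasSum.1 h1 i) i)
  simp only [Matrix.mul_smul, Matrix.smul_mul, h.conj_star_mul_self] at h2
  constructor
  · simpa [mul_comm, ← Complex.ofReal_pow] using h2 0
  · simpa [mul_comm, ← Complex.ofReal_pow] using h2 1

lemma hasSum_normSq (h : W.IsAntidiagonalIn U ν γ) :
    HasSum (fun s => ‖ν s‖ ^ 2) 1 ∧ HasSum (fun s => ‖γ s‖ ^ 2) 1 := by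
  have hU1 : (U : Op)ᴴ * (U : Op) = 1 := Unitary.coe_star_mul_self U
  have := h.hasSum_diag (r := fun _ => 1) (X := 1) (by simpa using W.hasSum_one)
  simpa [hU1] using this

end IsAntidiagonalIn

lemma tilted_star_mul_self (W : OQRW d) (u : Space d) (s : Lattice d) :
    (W.tilted u s)ᴴ * W.tilted u s = Real.exp (pairing u s) • ((W.L s)ᴴ * W.L s) := by
  rw [tilted, Matrix.conjTranspose_smul, star_trivial, Matrix.smul_mul, Matrix.mul_smul,
    smul_smul, ← Real.exp_add, add_halves]

namespace IsAntidiagonalIn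

lemma integrable_exp (h : W.IsAntidiagonalIn U ν γ) (hW : W.HasDeformations) (u : Space d) :
    Integrable (fun s => Real.exp (pairing u s)) (stepLaw ν) ∧
      Integrable (fun s => Real.exp (pairing u s)) (stepLaw γ) := by
  obtain ⟨X, hX⟩ := hW u
  simp only [tilted_star_mul_self] at hX
  have h2 := h.hasSum_diag hX
  simp only [integrable_stepLaw_iff, Real.norm_eq_abs, Real.abs_exp]
  exact ⟨h2.1.summable, h2.2.summable⟩

end IsAntidiagonalIn

end OQRW

lemma hasSum_stepMGF {d : ℕ} {a : Lattice d → ℂ} {u : Space d}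
    (hi : Integrable (fun s => Real.exp (pairing u s)) (stepLaw a)) :
    HasSum (fun s => ‖a s‖ ^ 2 * Real.exp (pairing u s)) (stepMGF a u) :=
  hasSum_integral_stepLaw hi

lemma stepMGF_pos {d : ℕ} {a : Lattice d → ℂ} {u : Space d}
    (ha : HasSum (fun s => ‖a s‖ ^ 2) 1)
    (hi : Integrable (fun s => Real.exp (pairing u s)) (stepLaw a)) : 0 < stepMGF a u := by
  have : NeZero (stepLaw a) := ⟨fun h0 => by
    have := stepLaw_univ_eq_one ha
    simp [h0] at this⟩
  exact integral_exp_pos hi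

namespace OQRW

variable {d : ℕ} {W : OQRW d} {U : Matrix.unitaryGroup (Fin 2) ℂ} {ν γ : Lattice d → ℂ}

/-- The off-diagonal coefficient `∑ₛ e^{⟨u,s⟩} γₛ ν̄ₛ` of the deformed map. -/
def coherence (ν γ : Lattice d → ℂ) (u : Space d) : ℂ :=
  ∑' s, (Real.exp (pairing u s) : ℂ) * (γ s * star (ν s))

lemma norm_exp_mul_mul_star_le (ν γ : Lattice d → ℂ) (u : Space d) (s : Lattice d) {t : ℝ}
    (ht : 0 < t) : ‖(Real.exp (pairing u s) : ℂ) * (γ s * star (ν s))‖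
      ≤ t / 2 * (‖γ s‖ ^ 2 * Real.exp (pairing u s))
        + t⁻¹ / 2 * (‖ν s‖ ^ 2 * Real.exp (pairing u s)) := by
  rw [norm_mul, norm_mul, norm_star, Complex.norm_real, Real.norm_of_nonneg (Real.exp_pos _).le]
  have h : ‖γ s‖ * ‖ν s‖ ≤ t / 2 * ‖γ s‖ ^ 2 + t⁻¹ / 2 * ‖ν s‖ ^ 2 := by
    have h1 : 0 ≤ t⁻¹ / 2 * (t * ‖γ s‖ - ‖ν s‖) ^ 2 := by positivity
    have h2 : t⁻¹ / 2 * (t * ‖γ s‖ - ‖ν s‖) ^ 2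
        = t / 2 * ‖γ s‖ ^ 2 + t⁻¹ / 2 * ‖ν s‖ ^ 2 - ‖γ s‖ * ‖ν s‖ := by
      field_simp
      ring
    linarith
  nlinarith [mul_le_mul_of_nonneg_left h (Real.exp_pos (pairing u s)).le]

lemma hasSum_coherence {u : Space d}
    (hν : Integrable (fun s => Real.exp (pairing u s)) (stepLaw ν))
    (hγ : Integrable (fun s => Real.exp (pairing u s)) (stepLaw γ)) :
    HasSum (fun s => (Real.exp (pairing u s) : ℂ) * (γ s * star (ν s))) (coherence ν γ u) :=
  (Summable.of_norm_bounded
    (((hasSum_stepMGF hγ).mul_left (1 / 2)).add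
      ((hasSum_stepMGF hν).mul_left (1⁻¹ / 2))).summable
    fun s => norm_exp_mul_mul_star_le ν γ u s one_pos).hasSum

/-- Cauchy–Schwarz, obtained from the weighted inequality between arithmetic and geometric means
with the optimal weight `t = √(E e^{⟨u,A⟩} / E e^{⟨u,B⟩})`. -/
lemma norm_coherence_le {u : Space d}
    (hν : Integrable (fun s => Real.exp (pairing u s)) (stepLaw ν))
    (hγ : Integrable (fun s => Real.exp (pairing u s)) (stepLaw γ))
    (pν : 0 < stepMGF ν u) (pγ : 0 < stepMGF γ u) :
    ‖coherence ν γ u‖ ≤ Real.sqrt (stepMGF ν u * stepMGF γ u) := by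
  have sν := Real.sqrt_pos.2 pν
  have sγ := Real.sqrt_pos.2 pγ
  have ht : 0 < Real.sqrt (stepMGF ν u) / Real.sqrt (stepMGF γ u) := div_pos sν sγ
  have h := tsum_of_norm_bounded
    (((hasSum_stepMGF hγ).mul_left _).add ((hasSum_stepMGF hν).mul_left _))
    (fun s => norm_exp_mul_mul_star_le ν γ u s ht)
  refine h.trans (le_of_eq ?_)
  rw [Real.sqrt_mul pν.le]
  nth_rewrite 2 [← Real.sq_sqrt pγ.le]
  nth_rewrite 3 [← Real.sq_sqrt pν.le]
  field_simp
  ring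

/-- In the antidiagonal basis the deformed map exchanges the diagonal entries, and the
off-diagonal ones. -/
lemma IsAntidiagonalIn.deformed_apply (h : W.IsAntidiagonalIn U ν γ) (hW : W.HasDeformations)
    (u : Space d) (X : Op) :
    W.deformed hW u (U * X * (U : Op)ᴴ)
      = U * !![stepMGF γ u * X 1 1, coherence ν γ u * X 1 0;
          star (coherence ν γ u) * X 0 1, stepMGF ν u * X 0 0] * (U : Op)ᴴ := by
  have hU1 : (U : Op)ᴴ * (U : Op) = 1 := Unitary.coe_star_mul_self U
  obtain ⟨hν, hγ⟩ := h.integrable_exp hW u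
  have hterm : ∀ s, W.tilted u s * (U * X * (U : Op)ᴴ) * (W.tilted u s)ᴴ
      = U * (Real.exp (pairing u s) •
          !![γ s * star (γ s) * X 1 1, γ s * star (ν s) * X 1 0;
            ν s * star (γ s) * X 0 1, ν s * star (ν s) * X 0 0]) * (U : Op)ᴴ := by
    intro s
    have h1 : W.tilted u s * (U * X * (U : Op)ᴴ) * (W.tilted u s)ᴴ
        = Real.exp (pairing u s) • (W.L s * (U * X * (U : Op)ᴴ) * (W.L s)ᴴ) := by
      rw [tilted, Matrix.conjTranspose_smul, star_trivial, Matrix.smul_mul, Matrix.smul_mul,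
        Matrix.mul_smul, smul_smul, ← Real.exp_add, add_halves]
    rw [h1, Matrix.mul_smul, Matrix.smul_mul]
    congr 1
    calc W.L s * (U * X * (U : Op)ᴴ) * (W.L s)ᴴ
        = U * (!![0, γ s; ν s, 0] * ((U : Op)ᴴ * U) * X * ((U : Op)ᴴ * U) *
            (!![0, γ s; ν s, 0])ᴴ) * (U : Op)ᴴ := by
          rw [h.L_eq s]
          simp only [Matrix.conjTranspose_mul, Matrix.conjTranspose_conjTranspose,
            Matrix.mul_assoc]
      _ = _ := by
          rw [hU1, Matrix.mul_one, Matrix.mul_one]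
          congr 2
          ext i j
          fin_cases i <;> fin_cases j <;>
            simp [Matrix.mul_apply, Fin.sum_univ_two, Matrix.vecMul, dotProduct] <;> ring
  have hdiag : ∀ {a : Lattice d → ℂ}, Integrable (fun s => Real.exp (pairing u s)) (stepLaw a) →
      ∀ z : ℂ, HasSum (fun s => (Real.exp (pairing u s) : ℂ) * (a s * star (a s) * z))
        (stepMGF a u * z) := by
    intro a ha z
    refine ((Complex.hasSum_ofReal.2 (hasSum_stepMGF ha)).mul_right z).congr_fun fun s => ?_
    rw [Complex.star_def, Complex.mul_conj']
    push_cast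
    ring
  have hco := hasSum_coherence hν hγ
  have hco' : HasSum (fun s => (Real.exp (pairing u s) : ℂ) * (ν s * star (γ s)))
      (star (coherence ν γ u)) := by
    refine hco.star.congr_fun fun s => ?_
    simp only [star_mul', star_star]
    simp only [Complex.star_def, Complex.conj_ofReal]
    ring
  have hsum : HasSum (fun s => Real.exp (pairing u s) •
          !![γ s * star (γ s) * X 1 1, γ s * star (ν s) * X 1 0;
            ν s * star (γ s) * X 0 1, ν s * star (ν s) * X 0 0])
      !![stepMGF γ u * X 1 1, coherence ν γ u * X 1 0;
          star (coherence ν γ u) * X 0 1, stepMGF ν u * X 0 0] := by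
    refine Pi.hasSum.2 fun i => Pi.hasSum.2 fun j => ?_
    fin_cases i <;> fin_cases j
    · simpa using hdiag hγ (X 1 1)
    · simpa [mul_assoc] using hco.mul_right (X 1 0)
    · simpa [mul_assoc] using hco'.mul_right (X 0 1)
    · simpa using hdiag hν (X 0 0)
  change ∑' s, W.tilted u s * (U * X * (U : Op)ᴴ) * (W.tilted u s)ᴴ = _
  simp only [hterm]
  exact (hsum.map ((AddMonoidHom.mulRight (U : Op)ᴴ).comp (AddMonoidHom.mulLeft (U : Op)))
      ((continuous_const.matrix_mul continuous_id).matrix_mul continuous_const)).tsum_eq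

/-- The eigenvalues of the deformed map are square roots of `E e^{⟨u,A⟩} E e^{⟨u,B⟩}` and of
`|z|²`, where `z` is the off-diagonal coefficient; the eigenvector for the largest one is diagonal
with entries `√(E e^{⟨u,B⟩})`, `√(E e^{⟨u,A⟩})`. -/
theorem IsAntidiagonalIn.spectralRadius_deformed (h : W.IsAntidiagonalIn U ν γ)
    (hW : W.HasDeformations) (u : Space d) :
    spectralRadius ℂ (W.deformed hW u)
      = ENNReal.ofReal (Real.sqrt (stepMGF ν u * stepMGF γ u)) := by
  have hU1 : (U : Op)ᴴ * (U : Op) = 1 := Unitary.coe_star_mul_self U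
  have hU2 : (U : Op) * (U : Op)ᴴ = 1 := Unitary.coe_mul_star_self U
  obtain ⟨hν, hγ⟩ := h.integrable_exp hW u
  have pν := stepMGF_pos h.hasSum_normSq.1 hν
  have pγ := stepMGF_pos h.hasSum_normSq.2 hγ
  have hcancel : ∀ X : Op, (U : Op)ᴴ * (U * X * (U : Op)ᴴ) * U = X := fun X => by
    calc (U : Op)ᴴ * (U * X * (U : Op)ᴴ) * U = ((U : Op)ᴴ * U) * X * ((U : Op)ᴴ * U) := by
          simp only [Matrix.mul_assoc]
      _ = X := by rw [hU1, Matrix.one_mul, Matrix.mul_one]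
  refine le_antisymm (iSup₂_le fun k hk => ?_) ?_
  · obtain ⟨ρ, hρ, hρ0⟩ := (Module.End.hasEigenvalue_iff_mem_spectrum.2 hk).exists_hasEigenvector
    rw [Module.End.mem_eigenspace_iff] at hρ
    set X : Op := (U : Op)ᴴ * ρ * U with hX
    have hρX : ρ = U * X * (U : Op)ᴴ := by
      calc ρ = ((U : Op) * (U : Op)ᴴ) * ρ * ((U : Op) * (U : Op)ᴴ) := by
            rw [hU2, Matrix.one_mul, Matrix.mul_one]
        _ = _ := by simp only [hX, Matrix.mul_assoc]
    have hX0 : X ≠ 0 := fun h0 => hρ0 (by rw [hρX, h0, Matrix.mul_zero, Matrix.zero_mul])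
    rw [hρX, h.deformed_apply hW u X] at hρ
    have hE := congrArg (fun Y : Op => (U : Op)ᴴ * Y * U) hρ
    simp only [Matrix.mul_smul, Matrix.smul_mul, hcancel] at hE
    have h00 : stepMGF γ u * X 1 1 = k * X 0 0 := by simpa using congrFun₂ hE 0 0
    have h01 : coherence ν γ u * X 1 0 = k * X 0 1 := by simpa using congrFun₂ hE 0 1
    have h10 : star (coherence ν γ u) * X 0 1 = k * X 1 0 := by simpa using congrFun₂ hE 1 0
    have h11 : stepMGF ν u * X 0 0 = k * X 1 1 := by simpa using congrFun₂ hE 1 1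
    have hnorm : ‖k‖ ^ 2 ≤ stepMGF ν u * stepMGF γ u := by
      have hdiag : k ^ 2 = stepMGF ν u * stepMGF γ u → ‖k‖ ^ 2 ≤ stepMGF ν u * stepMGF γ u := by
        intro hk2
        rw [← norm_pow, hk2, ← Complex.ofReal_mul, Complex.norm_real,
          Real.norm_of_nonneg (by positivity)]
      have hoff : k ^ 2 = coherence ν γ u * star (coherence ν γ u) →
          ‖k‖ ^ 2 ≤ stepMGF ν u * stepMGF γ u := by
        intro hk2
        rw [← norm_pow, hk2, norm_mul, norm_star, ← sq,
          ← Real.sq_sqrt (mul_pos pν pγ).le]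
        exact pow_le_pow_left₀ (norm_nonneg _) (norm_coherence_le hν hγ pν pγ) 2
      by_contra hlt
      have z00 : X 0 0 = 0 := by_contra fun hne => hlt (hdiag (mul_right_cancel₀ hne
        (by linear_combination -k * h00 - stepMGF γ u * h11)))
      have z01 : X 0 1 = 0 := by_contra fun hne => hlt (hoff (mul_right_cancel₀ hne
        (by linear_combination -k * h01 - coherence ν γ u * h10)))
      have z10 : X 1 0 = 0 := by_contra fun hne => hlt (hoff (mul_right_cancel₀ hne
        (by linear_combination -k * h10 - star (coherence ν γ u) * h01)))
      have z11 : X 1 1 = 0 := by_contra fun hne => hlt (hdiag (mul_right_cancel₀ hne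
        (by linear_combination -k * h11 - stepMGF ν u * h00)))
      refine hX0 (Matrix.ext fun i j => ?_)
      fin_cases i <;> fin_cases j
      exacts [z00, z01, z10, z11]
    rw [← enorm_eq_nnnorm, ← ofReal_norm]
    exact ENNReal.ofReal_le_ofReal (Real.le_sqrt_of_sq_le hnorm)
  · let k : ℂ := (Real.sqrt (stepMGF ν u * stepMGF γ u) : ℝ)
    let X : Op := !![(Real.sqrt (stepMGF γ u) : ℂ), 0; 0, (Real.sqrt (stepMGF ν u) : ℂ)]
    have hk : k ∈ spectrum ℂ (W.deformed hW u) := by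
      refine Module.End.hasEigenvalue_iff_mem_spectrum.1
        (Module.End.hasEigenvalue_of_hasEigenvector (x := U * X * (U : Op)ᴴ) ⟨?_, ?_⟩)
      · rw [Module.End.mem_eigenspace_iff, h.deformed_apply hW u X, ← Matrix.smul_mul,
          ← Matrix.mul_smul]
        congr 2
        have e1 : (stepMGF γ u : ℂ) = (Real.sqrt (stepMGF γ u) : ℂ) * Real.sqrt (stepMGF γ u) := by
          rw [← Complex.ofReal_mul, Real.mul_self_sqrt pγ.le]
        have e2 : (stepMGF ν u : ℂ) = (Real.sqrt (stepMGF ν u) : ℂ) * Real.sqrt (stepMGF ν u) := by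
          rw [← Complex.ofReal_mul, Real.mul_self_sqrt pν.le]
        have e3 : k = (Real.sqrt (stepMGF ν u) : ℂ) * Real.sqrt (stepMGF γ u) := by
          rw [← Complex.ofReal_mul, ← Real.sqrt_mul pν.le]
        ext i j
        fin_cases i <;> fin_cases j
        · simp [X, e3, -Complex.ofReal_mul]
          linear_combination (Real.sqrt (stepMGF ν u) : ℂ) * e1
        · simp [X]
        · simp [X]
        · simp [X, e3]
          linear_combination (Real.sqrt (stepMGF γ u) : ℂ) * e2
      · intro h0
        have := congrArg (fun Y : Op => ((U : Op)ᴴ * Y * U) 0 0) h0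
        simp only [hcancel] at this
        simp [X, (Real.sqrt_pos.2 pγ).ne'] at this
    refine le_trans (le_of_eq ?_) (le_iSup₂ (f := fun k _ => (‖k‖₊ : ℝ≥0∞)) k hk)
    rw [← enorm_eq_nnnorm, ← ofReal_norm, Complex.norm_real,
      Real.norm_of_nonneg (Real.sqrt_nonneg _)]

end OQRW

/-! ### Inhomogeneous random walks -/

section Walk

variable {V : Type} [AddCommGroup V]

/-- The weight `r(x₀) f₀(x₁ - x₀) ⋯ fₙ₋₁(xₙ - xₙ₋₁)` that a random walk with independent steps
gives to the path `x₀, …, xₙ`. -/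
def walkWeight (r : V → ℝ≥0∞) (f : ℕ → V → ℝ≥0∞) (n : ℕ) (x : ℕ → V) : ℝ≥0∞ :=
  r (x 0) * ∏ k ∈ Finset.range n, f k (x (k + 1) - x k)

/-- Extend a path of length `n` by zero to an infinite one. -/
def extendTuple {n : ℕ} (x : Fin (n + 1) → V) : ℕ → V :=
  fun k => if h : k < n + 1 then x ⟨k, h⟩ else 0

lemma extendTuple_snoc_of_le {n : ℕ} (x : Fin (n + 1) → V) (v : V) {k : ℕ} (hk : k ≤ n) :
    extendTuple (Fin.snoc (α := fun _ => V) x v) k = extendTuple x k := by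
  rw [extendTuple, extendTuple, dif_pos (by omega), dif_pos (by omega)]
  exact Fin.snoc_castSucc (α := fun _ => V) v x ⟨k, by omega⟩

lemma extendTuple_snoc_last {n : ℕ} (x : Fin (n + 1) → V) (v : V) :
    extendTuple (Fin.snoc (α := fun _ => V) x v) (n + 1) = v := by
  rw [extendTuple, dif_pos (by omega)]
  exact Fin.snoc_last (α := fun _ => V) v x

lemma walkWeight_extendTuple_snoc (r : V → ℝ≥0∞) (f : ℕ → V → ℝ≥0∞) {n : ℕ}
    (x : Fin (n + 1) → V) (v : V) :
    walkWeight r f (n + 1) (extendTuple (Fin.snoc (α := fun _ => V) x v))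
      = walkWeight r f n (extendTuple x) * f n (v - extendTuple x n) := by
  rw [walkWeight, walkWeight, Finset.prod_range_succ, extendTuple_snoc_last,
    extendTuple_snoc_of_le x v (Nat.zero_le n), extendTuple_snoc_of_le x v le_rfl, ← mul_assoc]
  congr 2
  refine Finset.prod_congr rfl fun k hk => ?_
  have := Finset.mem_range.1 hk
  rw [extendTuple_snoc_of_le x v (by omega), extendTuple_snoc_of_le x v (by omega)]

lemma tsum_walkWeight (r : V → ℝ≥0∞) (f : ℕ → V → ℝ≥0∞) (n : ℕ) :
    ∑' x : Fin (n + 1) → V, walkWeight r f n (extendTuple x)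
      = (∑' v, r v) * ∏ k ∈ Finset.range n, ∑' s, f k s := by
  induction n with
  | zero =>
    rw [← (Equiv.funUnique (Fin 1) V).symm.tsum_eq]
    simp [walkWeight, extendTuple]
  | succ n ih =>
    rw [← (Fin.snocEquiv fun _ : Fin (n + 2) => V).tsum_eq, ENNReal.tsum_prod', ENNReal.tsum_comm,
      Finset.prod_range_succ, ← mul_assoc, ← ih, ← ENNReal.tsum_mul_right]
    refine tsum_congr fun x => ?_
    have h : ∀ v : V, walkWeight r f (n + 1)
        (extendTuple ((Fin.snocEquiv fun _ : Fin (n + 2) => V) (v, x)))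
          = walkWeight r f n (extendTuple x) * f n (v - extendTuple x n) := fun v =>
      walkWeight_extendTuple_snoc r f x v
    simp only [h]
    rw [ENNReal.tsum_mul_left]
    congr 1
    exact (Equiv.subRight (extendTuple x n)).tsum_eq (f n)

/-- An exponential functional of the displacement is absorbed into the step weights. -/
lemma mul_walkWeight (r : V → ℝ≥0∞) (f : ℕ → V → ℝ≥0∞) {e : V → ℝ≥0∞} (h0 : e 0 = 1)
    (hadd : ∀ v w, e (v + w) = e v * e w) (n : ℕ) (x : ℕ → V) :
    e (x n - x 0) * walkWeight r f n x = walkWeight r (fun k s => f k s * e s) n x := by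
  have h : e (x n - x 0) = ∏ k ∈ Finset.range n, e (x (k + 1) - x k) := by
    induction n with
    | zero => simp [h0]
    | succ n ih =>
      rw [Finset.prod_range_succ, ← ih, ← hadd]
      congr 1
      abel
  rw [h, walkWeight, walkWeight, Finset.prod_mul_distrib]
  ring

variable [MeasurableSpace V] [DiscreteMeasurableSpace V] [Countable V]

lemma lintegral_path_eq_tsum (P : Measure (ℕ → V)) (n : ℕ) (F : (ℕ → V) → ℝ≥0∞)
    (hF : ∀ x y, (∀ k ≤ n, x k = y k) → F x = F y) :
    ∫⁻ ω, F ω ∂P = ∑' x : Fin (n + 1) → V,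
      F (extendTuple x) * P {ω | ∀ k ≤ n, ω k = extendTuple x k} := by
  have hext : ∀ (ω : ℕ → V) (k : ℕ), k ≤ n →
      extendTuple (fun i : Fin (n + 1) => ω i) k = ω k := fun ω k hk => by
    rw [extendTuple, dif_pos (by omega)]
  have hm : Measurable fun (ω : ℕ → V) (i : Fin (n + 1)) => ω i := by fun_prop
  calc ∫⁻ ω, F ω ∂P = ∫⁻ ω, F (extendTuple fun i : Fin (n + 1) => ω i) ∂P :=
        lintegral_congr fun ω => hF _ _ fun k hk => (hext ω k hk).symm
    _ = ∫⁻ x, F (extendTuple x) ∂P.map fun (ω : ℕ → V) (i : Fin (n + 1)) => ω i :=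
        (lintegral_map (f := fun x : Fin (n + 1) → V => F (extendTuple x)) .of_discrete hm).symm
    _ = _ := by
        rw [lintegral_countable']
        refine tsum_congr fun x => ?_
        rw [Measure.map_apply hm (measurableSet_singleton _)]
        congr 2
        ext ω
        simp only [Set.mem_preimage, Set.mem_singleton_iff, Set.mem_ofPred_eq]
        constructor
        · rintro rfl k hk
          exact (hext ω k hk).symm
        · intro h
          funext i
          rw [h i (by omega), extendTuple, dif_pos i.2]

end Walk

/-! ### The position process is a mixture of two random walks -/

section Pairing

variable {d : ℕ}

lemma pairing_add (u : Space d) (v w : Lattice d) :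
    pairing u (v + w) = pairing u v + pairing u w := by
  have h : toSpace (v + w) = toSpace v + toSpace w := by
    ext i
    simp [toSpace]
  rw [pairing, h, inner_add_right]
  rfl

lemma pairing_zero (u : Space d) : pairing u (0 : Lattice d) = 0 := by
  simpa using pairing_add u 0 0

lemma measurable_displacement {E : Type} [MeasurableSpace E] (p : ℕ) (g : Lattice d → E) :
    Measurable fun ω : ℕ → Lattice d => g (ω p - ω 0) := by
  have hd : Measurable fun ω : ℕ → Lattice d => ω p - ω 0 := by fun_prop
  have hg : Measurable g := .of_discrete
  exact hg.comp hd

end Pairing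

/-- The sequence `a, b, a, b, …`. -/
def alternate {α : Type} (a b : α) (k : ℕ) : α := if Even k then a else b

namespace OQRW

variable {d : ℕ} {W : OQRW d} {U : Matrix.unitaryGroup (Fin 2) ℂ} {ν γ : Lattice d → ℂ}

/-- The mass of the `j`-th basis state of the antidiagonal basis in the initial state at `v`. -/
def initialMass (U : Matrix.unitaryGroup (Fin 2) ℂ) (ρ : InitialState d) (j : Fin 2)
    (v : Lattice d) : ℝ≥0∞ :=
  ENNReal.ofReal (((U : Op)ᴴ * ρ.op v * U) j j).re

lemma conj_diag_re_nonneg {X : Op} (hX : X.PosSemidef) (U : Matrix.unitaryGroup (Fin 2) ℂ)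
    (j : Fin 2) : 0 ≤ (((U : Op)ᴴ * X * U) j j).re :=
  (Complex.le_def.1 (hX.conjTranspose_mul_mul_same (U : Op)).diag_nonneg).1

lemma trace_conj_unitary (U : Matrix.unitaryGroup (Fin 2) ℂ) (X : Op) :
    ((U : Op)ᴴ * X * U).trace = X.trace := by
  have hU2 : (U : Op) * (U : Op)ᴴ = 1 := Unitary.coe_mul_star_self U
  rw [Matrix.mul_assoc, Matrix.trace_mul_comm, Matrix.mul_assoc, hU2, Matrix.mul_one]

lemma tsum_initialMass_add (U : Matrix.unitaryGroup (Fin 2) ℂ) (ρ : InitialState d) :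
    ∑' v, initialMass U ρ 0 v + ∑' v, initialMass U ρ 1 v = 1 := by
  rw [← ENNReal.tsum_add]
  have h := tsum_ofReal_trace ρ.posSemidef ρ.hasSum_trace
  rw [Complex.one_re, ENNReal.ofReal_one] at h
  rw [← h]
  refine tsum_congr fun v => ?_
  rw [initialMass, initialMass, ← ENNReal.ofReal_add (conj_diag_re_nonneg (ρ.posSemidef v) U 0)
    (conj_diag_re_nonneg (ρ.posSemidef v) U 1), ← trace_conj_unitary U, Matrix.trace_fin_two,
    Complex.add_re]

/-- An antidiagonal transition swaps the diagonal entries of the internal state, multiplying them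
by `|νₛ|²` and `|γₛ|²`. -/
lemma IsAntidiagonalIn.conj_step (h : W.IsAntidiagonalIn U ν γ) (X : Op) (s : Lattice d) :
    (((U : Op)ᴴ * (W.L s * X * (W.L s)ᴴ) * U) 0 0).re
        = ‖γ s‖ ^ 2 * (((U : Op)ᴴ * X * U) 1 1).re ∧
      (((U : Op)ᴴ * (W.L s * X * (W.L s)ᴴ) * U) 1 1).re
        = ‖ν s‖ ^ 2 * (((U : Op)ᴴ * X * U) 0 0).re := by
  have hU1 : (U : Op)ᴴ * (U : Op) = 1 := Unitary.coe_star_mul_self U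
  have hconj : (U : Op)ᴴ * (W.L s * X * (W.L s)ᴴ) * U
      = !![0, γ s; ν s, 0] * ((U : Op)ᴴ * X * U) * (!![0, γ s; ν s, 0])ᴴ := by
    rw [h.L_eq s]
    calc (U : Op)ᴴ * ((U : Op) * !![0, γ s; ν s, 0] * (U : Op)ᴴ * X *
          ((U : Op) * !![0, γ s; ν s, 0] * (U : Op)ᴴ)ᴴ) * U
        = ((U : Op)ᴴ * U) * !![0, γ s; ν s, 0] * ((U : Op)ᴴ * X * U) * (!![0, γ s; ν s, 0])ᴴ *
            ((U : Op)ᴴ * U) := by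
          simp only [Matrix.conjTranspose_mul, Matrix.conjTranspose_conjTranspose,
            Matrix.mul_assoc]
      _ = _ := by rw [hU1, Matrix.one_mul, Matrix.mul_one]
  rw [hconj]
  set Y := (U : Op)ᴴ * X * U
  have hre : ∀ a z : ℂ, (a * z * star a).re = ‖a‖ ^ 2 * z.re := fun a z => by
    rw [mul_right_comm, Complex.star_def, Complex.mul_conj', ← Complex.ofReal_pow,
      Complex.re_ofReal_mul]
  constructor
  · rw [← hre]
    simp [Matrix.mul_apply, Fin.sum_univ_two, Matrix.vecMul, dotProduct]
  · rw [← hre]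
    simp [Matrix.mul_apply, Fin.sum_univ_two, Matrix.vecMul, dotProduct]

/-- The weight of the path `x₀, …, xₙ` when the internal state starts in the `j`-th basis state and
the amplitudes of the steps alternate between `a` and `b`, starting with `a`. -/
def branchWeight (U : Matrix.unitaryGroup (Fin 2) ℂ) (ρ : InitialState d) (j : Fin 2)
    (a b : Lattice d → ℂ) (n : ℕ) (x : ℕ → Lattice d) : ℝ :=
  (((U : Op)ᴴ * ρ.op (x 0) * U) j j).re *
    ∏ k ∈ Finset.range n, ‖alternate a b k (x (k + 1) - x k)‖ ^ 2

lemma IsAntidiagonalIn.diag_trajectoryState (h : W.IsAntidiagonalIn U ν γ) (ρ : InitialState d)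
    (x : ℕ → Lattice d) (n : ℕ) :
    (((U : Op)ᴴ * W.trajectoryState ρ x n * U) 0 0).re
        = alternate (branchWeight U ρ 0 ν γ n x) (branchWeight U ρ 1 γ ν n x) n ∧
      (((U : Op)ᴴ * W.trajectoryState ρ x n * U) 1 1).re
        = alternate (branchWeight U ρ 1 γ ν n x) (branchWeight U ρ 0 ν γ n x) n := by
  induction n with
  | zero => simp [alternate, branchWeight, trajectoryState]
  | succ n ih =>
    obtain ⟨h0, h1⟩ := h.conj_step (W.trajectoryState ρ x n) (x (n + 1) - x n)
    rw [trajectoryState, h0, h1, ih.1, ih.2]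
    by_cases hn : Even n <;>
      simp [alternate, branchWeight, Finset.prod_range_succ, Nat.even_add_one, hn] <;>
      constructor <;> ring

/-- Splitting by the initial basis state, cylinder probabilities are sums of the weights of two
random walks with independent alternating steps. -/
lemma IsAntidiagonalIn.trajectoryWeight_eq (h : W.IsAntidiagonalIn U ν γ) (ρ : InitialState d)
    (n : ℕ) (x : ℕ → Lattice d) :
    W.trajectoryWeight ρ n x
      = walkWeight (initialMass U ρ 0)
          (fun k s => ENNReal.ofReal (‖alternate ν γ k s‖ ^ 2)) n x
        + walkWeight (initialMass U ρ 1)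
          (fun k s => ENNReal.ofReal (‖alternate γ ν k s‖ ^ 2)) n x := by
  have hb : ∀ (j : Fin 2) (a b : Lattice d → ℂ), walkWeight (initialMass U ρ j)
      (fun k s => ENNReal.ofReal (‖alternate a b k s‖ ^ 2)) n x
        = ENNReal.ofReal (branchWeight U ρ j a b n x) := fun j a b => by
    rw [walkWeight, branchWeight, initialMass,
      ENNReal.ofReal_mul (conj_diag_re_nonneg (ρ.posSemidef _) U j),
      ENNReal.ofReal_prod_of_nonneg fun k _ => by positivity]
  have hnonneg : ∀ (j : Fin 2) (a b : Lattice d → ℂ), 0 ≤ branchWeight U ρ j a b n x :=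
    fun j a b => mul_nonneg (conj_diag_re_nonneg (ρ.posSemidef _) U j)
      (Finset.prod_nonneg fun k _ => by positivity)
  rw [hb, hb, ← ENNReal.ofReal_add (hnonneg _ _ _) (hnonneg _ _ _), trajectoryWeight,
    ← trace_conj_unitary U, Matrix.trace_fin_two, Complex.add_re,
    (h.diag_trajectoryState ρ x n).1, (h.diag_trajectoryState ρ x n).2]
  congr 1
  by_cases hn : Even n
  · simp [alternate, hn]
  · simp [alternate, hn, add_comm]

lemma tsum_ofReal_mul_exp {a : Lattice d → ℂ} {u : Space d}
    (hi : Integrable (fun s => Real.exp (pairing u s)) (stepLaw a)) :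
    ∑' s, ENNReal.ofReal (‖a s‖ ^ 2) * ENNReal.ofReal (Real.exp (pairing u s))
      = ENNReal.ofReal (stepMGF a u) := by
  have h := hasSum_stepMGF hi
  rw [← h.tsum_eq, ENNReal.ofReal_tsum_of_nonneg (fun s => by positivity) h.summable]
  exact tsum_congr fun s => (ENNReal.ofReal_mul (by positivity)).symm

/-- The moment generating function of the displacement, as a mixture over the two possible initial
basis states. -/
lemma IsAntidiagonalIn.lintegral_exp_displacement (h : W.IsAntidiagonalIn U ν γ)
    (hW : W.HasDeformations) (ρ : InitialState d) (u : Space d) (p : ℕ) :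
    ∫⁻ ω, ENNReal.ofReal (Real.exp (pairing u (ω p - ω 0))) ∂W.law ρ
      = (∑' v, initialMass U ρ 0 v) *
          ∏ k ∈ Finset.range p, ENNReal.ofReal (alternate (stepMGF ν u) (stepMGF γ u) k)
        + (∑' v, initialMass U ρ 1 v) *
          ∏ k ∈ Finset.range p, ENNReal.ofReal (alternate (stepMGF γ u) (stepMGF ν u) k) := by
  obtain ⟨hν, hγ⟩ := h.integrable_exp hW u
  rw [lintegral_path_eq_tsum (W.law ρ) p _ fun x y hxy => by
    rw [hxy p le_rfl, hxy 0 (Nat.zero_le p)]]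
  have hmul : ∀ r f (x : ℕ → Lattice d), ENNReal.ofReal (Real.exp (pairing u (x p - x 0))) *
      walkWeight r f p x = walkWeight r (fun k s => f k s *
        ENNReal.ofReal (Real.exp (pairing u s))) p x := fun r f x =>
    mul_walkWeight r f (e := fun s => ENNReal.ofReal (Real.exp (pairing u s)))
      (by simp [pairing_zero])
      (fun v w => by rw [pairing_add, Real.exp_add, ENNReal.ofReal_mul (Real.exp_pos _).le]) p x
  have hstep : ∀ {a b : Lattice d → ℂ},
      Integrable (fun s => Real.exp (pairing u s)) (stepLaw a) →
      Integrable (fun s => Real.exp (pairing u s)) (stepLaw b) → ∀ k,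
      ∑' s, ENNReal.ofReal (‖alternate a b k s‖ ^ 2) * ENNReal.ofReal (Real.exp (pairing u s))
        = ENNReal.ofReal (alternate (stepMGF a u) (stepMGF b u) k) := by
    intro a b ha hb k
    by_cases hk : Even k
    · simpa only [alternate, if_pos hk] using tsum_ofReal_mul_exp ha
    · simpa only [alternate, if_neg hk] using tsum_ofReal_mul_exp hb
  simp only [(W.law_spec ρ).2, h.trajectoryWeight_eq, mul_add, hmul]
  rw [ENNReal.tsum_add, tsum_walkWeight, tsum_walkWeight]
  simp only [hstep hν hγ, hstep hγ hν]

lemma IsAntidiagonalIn.exists_integral_exp_displacement (h : W.IsAntidiagonalIn U ν γ)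
    (hW : W.HasDeformations) (ρ : InitialState d) :
    ∃ w₀ w₁ : ℝ, 0 ≤ w₀ ∧ 0 ≤ w₁ ∧ w₀ + w₁ = 1 ∧ ∀ (u : Space d) (p : ℕ),
      Integrable (fun ω => Real.exp (pairing u (ω p - ω 0))) (W.law ρ) ∧
      ∫ ω, Real.exp (pairing u (ω p - ω 0)) ∂W.law ρ
        = w₀ * ∏ k ∈ Finset.range p, alternate (stepMGF ν u) (stepMGF γ u) k
          + w₁ * ∏ k ∈ Finset.range p, alternate (stepMGF γ u) (stepMGF ν u) k := by
  have hsum := tsum_initialMass_add U ρ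
  set m₀ := ∑' v, initialMass U ρ 0 v
  set m₁ := ∑' v, initialMass U ρ 1 v
  have h0 : m₀ ≠ ∞ := fun h' => by simp [h'] at hsum
  have h1 : m₁ ≠ ∞ := fun h' => by simp [h'] at hsum
  refine ⟨m₀.toReal, m₁.toReal, ENNReal.toReal_nonneg, ENNReal.toReal_nonneg, ?_, fun u p => ?_⟩
  · rw [← ENNReal.toReal_add h0 h1, hsum, ENNReal.toReal_one]
  have hpos : ∀ {a b : Lattice d → ℂ}, 0 < stepMGF a u → 0 < stepMGF b u → ∀ k,
      0 ≤ alternate (stepMGF a u) (stepMGF b u) k := by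
    intro a b ha hb k
    rw [alternate]
    split_ifs
    exacts [ha.le, hb.le]
  obtain ⟨hν, hγ⟩ := h.integrable_exp hW u
  have pν := stepMGF_pos h.hasSum_normSq.1 hν
  have pγ := stepMGF_pos h.hasSum_normSq.2 hγ
  have hl := h.lintegral_exp_displacement hW ρ u p
  change _ = m₀ * _ + m₁ * _ at hl
  rw [← ENNReal.ofReal_prod_of_nonneg fun k _ => hpos pν pγ k,
    ← ENNReal.ofReal_prod_of_nonneg fun k _ => hpos pγ pν k,
    ← ENNReal.ofReal_toReal h0, ← ENNReal.ofReal_toReal h1,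
    ← ENNReal.ofReal_mul ENNReal.toReal_nonneg, ← ENNReal.ofReal_mul ENNReal.toReal_nonneg,
    ← ENNReal.ofReal_add
      (mul_nonneg ENNReal.toReal_nonneg (Finset.prod_nonneg fun k _ => hpos pν pγ k))
      (mul_nonneg ENNReal.toReal_nonneg (Finset.prod_nonneg fun k _ => hpos pγ pν k))] at hl
  have hmeas : Measurable fun ω : ℕ → Lattice d => Real.exp (pairing u (ω p - ω 0)) :=
    measurable_displacement p fun v => Real.exp (pairing u v)
  constructor
  · refine (lintegral_ofReal_ne_top_iff_integrable hmeas.aestronglyMeasurable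
      (ae_of_all _ fun ω => (Real.exp_pos _).le)).1 ?_
    rw [hl]
    exact ENNReal.ofReal_ne_top
  · rw [integral_eq_lintegral_of_nonneg_ae (ae_of_all _ fun ω => (Real.exp_pos _).le)
      hmeas.aestronglyMeasurable, hl, ENNReal.toReal_ofReal]
    exact add_nonneg
      (mul_nonneg ENNReal.toReal_nonneg (Finset.prod_nonneg fun k _ => hpos pν pγ k))
      (mul_nonneg ENNReal.toReal_nonneg (Finset.prod_nonneg fun k _ => hpos pγ pν k))

end OQRW

/-! ### The limiting cumulant generating function -/

/-- The product of the first `p` terms of an alternating sequence is, up to a bounded factor, the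
`p`-th power of the geometric mean. -/
lemma abs_log_prod_alternate_sub_le {a b : ℝ} (ha : 0 < a) (hb : 0 < b) (p : ℕ) :
    |Real.log (∏ k ∈ Finset.range p, alternate a b k) - p * (1 / 2 * (Real.log a + Real.log b))|
      ≤ |Real.log a - Real.log b| / 2 := by
  have hne : ∀ k, alternate a b k ≠ 0 := fun k => by
    rw [alternate]
    split_ifs
    exacts [ha.ne', hb.ne']
  have h : Real.log (∏ k ∈ Finset.range p, alternate a b k)
      - p * (1 / 2 * (Real.log a + Real.log b))
        = if Even p then 0 else (Real.log a - Real.log b) / 2 := by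
    rw [Real.log_prod fun k _ => hne k]
    induction p with
    | zero => simp
    | succ p ih =>
      rw [Finset.sum_range_succ, Nat.cast_succ]
      by_cases hp : Even p
      · rw [if_pos hp] at ih
        rw [if_neg (by simpa [Nat.even_add_one] using hp), alternate, if_pos hp]
        linarith
      · rw [if_neg hp] at ih
        rw [if_pos (by simpa [Nat.even_add_one] using hp), alternate, if_neg hp]
        linarith
  rw [h]
  split_ifs
  · rw [abs_zero]
    positivity
  · rw [abs_div, abs_two]

lemma tendsto_log_mixture {a b w₀ w₁ : ℝ} (ha : 0 < a) (hb : 0 < b) (h0 : 0 ≤ w₀) (h1 : 0 ≤ w₁)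
    (hw : w₀ + w₁ = 1) :
    Tendsto (fun p : ℕ => 1 / (p : ℝ) * Real.log
      (w₀ * ∏ k ∈ Finset.range p, alternate a b k + w₁ * ∏ k ∈ Finset.range p, alternate b a k))
      atTop (𝓝 (1 / 2 * (Real.log a + Real.log b))) := by
  set c := 1 / 2 * (Real.log a + Real.log b) with hc
  set D := |Real.log a - Real.log b| / 2 with hD
  have hpos : ∀ {a b : ℝ}, 0 < a → 0 < b → ∀ p : ℕ,
      0 < ∏ k ∈ Finset.range p, alternate a b k := fun {a b} ha hb p =>
    Finset.prod_pos fun k _ => by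
      rw [alternate]
      split_ifs
      exacts [ha, hb]
  have hbound : ∀ p : ℕ, |Real.log (w₀ * ∏ k ∈ Finset.range p, alternate a b k
      + w₁ * ∏ k ∈ Finset.range p, alternate b a k) - p * c| ≤ D := by
    intro p
    have hA := abs_le.1 (abs_log_prod_alternate_sub_le ha hb p)
    have hB := abs_log_prod_alternate_sub_le hb ha p
    rw [abs_sub_comm (Real.log b), add_comm (Real.log b)] at hB
    replace hB := abs_le.1 hB
    rw [← hc, ← hD] at hA hB
    have pA := hpos ha hb p
    have pB := hpos hb ha p
    set A := ∏ k ∈ Finset.range p, alternate a b k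
    set B := ∏ k ∈ Finset.range p, alternate b a k
    have hA1 : Real.exp (p * c - D) ≤ A := (Real.le_log_iff_exp_le pA).1 (by linarith)
    have hA2 : A ≤ Real.exp (p * c + D) := (Real.log_le_iff_le_exp pA).1 (by linarith)
    have hB1 : Real.exp (p * c - D) ≤ B := (Real.le_log_iff_exp_le pB).1 (by linarith)
    have hB2 : B ≤ Real.exp (p * c + D) := (Real.log_le_iff_le_exp pB).1 (by linarith)
    have e1 : Real.exp (p * c - D) ≤ w₀ * A + w₁ * B := by
      have : Real.exp (p * c - D) = w₀ * Real.exp (p * c - D) + w₁ * Real.exp (p * c - D) := by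
        rw [← add_mul, hw, one_mul]
      rw [this]
      gcongr
    have e2 : w₀ * A + w₁ * B ≤ Real.exp (p * c + D) := by
      have : Real.exp (p * c + D) = w₀ * Real.exp (p * c + D) + w₁ * Real.exp (p * c + D) := by
        rw [← add_mul, hw, one_mul]
      rw [this]
      gcongr
    have e0 : 0 < w₀ * A + w₁ * B := (Real.exp_pos _).trans_le e1
    rw [abs_le]
    constructor
    · linarith [(Real.le_log_iff_exp_le e0).2 e1]
    · linarith [(Real.log_le_iff_le_exp e0).2 e2]
  refine tendsto_iff_norm_sub_tendsto_zero.2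
    (squeeze_zero' (Eventually.of_forall fun p => norm_nonneg _) ?_
      (tendsto_const_div_atTop_nhds_zero_nat D))
  filter_upwards [eventually_gt_atTop 0] with p hp
  have hp' : (0 : ℝ) < p := by exact_mod_cast hp
  rw [Real.norm_eq_abs, le_div_iff₀ hp']
  have hscale : ∀ L : ℝ, |1 / (p : ℝ) * L - c| * p = |L - p * c| := fun L => by
    nth_rewrite 2 [← abs_of_pos hp']
    rw [← abs_mul]
    congr 1
    field_simp
  rw [hscale]
  exact hbound p

section Regularity

variable {d : ℕ} {a : Lattice d → ℂ}

lemma continuous_stepMGF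
    (hi : ∀ u : Space d, Integrable (fun s => Real.exp (pairing u s)) (stepLaw a)) :
    Continuous (stepMGF a) := by
  have hconv : ConvexOn ℝ Set.univ (stepMGF a) := by
    refine ⟨convex_univ, fun x _ y _ s t hs ht hst => ?_⟩
    simp only [stepMGF, smul_eq_mul]
    rw [← integral_const_mul, ← integral_const_mul,
      ← integral_add ((hi x).const_mul s) ((hi y).const_mul t)]
    refine integral_mono (hi _) (((hi x).const_mul s).add ((hi y).const_mul t)) fun v => ?_
    have h := convexOn_exp.2 (Set.mem_univ (pairing x v)) (Set.mem_univ (pairing y v)) hs ht hst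
    simpa [pairing, inner_add_left, real_inner_smul_left] using h
  exact continuousOn_univ.1 (hconv.continuousOn isOpen_univ)

/-- Along a line, `stepMGF` is a multiple of the moment generating function of a real variable
under an exponentially tilted measure. -/
lemma differentiableAt_stepMGF_line
    (hi : ∀ u : Space d, Integrable (fun s => Real.exp (pairing u s)) (stepLaw a))
    (hpos : ∀ u : Space d, 0 < stepMGF a u) (u v : Space d) :
    DifferentiableAt ℝ (fun t : ℝ => stepMGF a (u + t • v)) 0 := by
  have hmul : ∀ (t : ℝ) (s : Lattice d),
      Real.exp (pairing u s) * Real.exp (t * pairing v s) = Real.exp (pairing (u + t • v) s) := by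
    intro t s
    rw [← Real.exp_add]
    simp [pairing, inner_add_left, real_inner_smul_left]
  have hset : ProbabilityTheory.integrableExpSet (pairing v)
      ((stepLaw a).tilted (pairing u)) = Set.univ := by
    refine Set.eq_univ_of_forall fun t => ?_
    change Integrable _ _
    rw [integrable_tilted_iff (hi u)]
    simpa only [smul_eq_mul, hmul] using hi (u + t • v)
  have hmgf : (fun t : ℝ => stepMGF a (u + t • v))
      = fun t => stepMGF a u *
        ProbabilityTheory.mgf (pairing v) ((stepLaw a).tilted (pairing u)) t := by
    funext t
    rw [ProbabilityTheory.mgf, integral_tilted]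
    simp only [smul_eq_mul, div_mul_eq_mul_div, hmul]
    rw [integral_div]
    exact (mul_div_cancel₀ _ (hpos u).ne').symm
  rw [hmgf]
  exact (ProbabilityTheory.differentiableAt_mgf (by simp [hset])).const_mul _

end Regularity

namespace OQRW

variable {d : ℕ} {W : OQRW d} {U : Matrix.unitaryGroup (Fin 2) ℂ} {ν γ : Lattice d → ℂ}

lemma IsAntidiagonalIn.hasScaledCumulantLimit (h : W.IsAntidiagonalIn U ν γ)
    (hW : W.HasDeformations) (ρ : InitialState d) :
    HasScaledCumulantLimit (meanDisplacementLaw (W.law ρ))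
      (fun u => 1 / 2 * (Real.log (stepMGF ν u) + Real.log (stepMGF γ u))) := by
  have := (W.law_spec ρ).1
  have hν := fun u => (h.integrable_exp hW u).1
  have hγ := fun u => (h.integrable_exp hW u).2
  have pν := fun u => stepMGF_pos h.hasSum_normSq.1 (hν u)
  have pγ := fun u => stepMGF_pos h.hasSum_normSq.2 (hγ u)
  obtain ⟨w₀, w₁, h0, h1, hw, hint⟩ := h.exists_integral_exp_displacement hW ρ
  have hm : ∀ p : ℕ, Measurable fun ω : ℕ → Lattice d => (1 / (p : ℝ)) • toSpace (ω p - ω 0) :=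
    fun p => measurable_displacement p fun v => (1 / (p : ℝ)) • toSpace v
  have hscale : ∀ {p : ℕ}, 0 < p → ∀ (u : Space d) (ω : ℕ → Lattice d),
      (p : ℝ) * inner ℝ u ((1 / (p : ℝ)) • toSpace (ω p - ω 0)) = pairing u (ω p - ω 0) := by
    intro p hp u ω
    have hp' : (p : ℝ) ≠ 0 := by exact_mod_cast hp.ne'
    rw [real_inner_smul_right, pairing]
    field_simp
  refine ⟨fun p => Measure.isProbabilityMeasure_map (hm p).aemeasurable, fun u p => ?_,
    fun u => ?_⟩
  · rw [meanDisplacementLaw, integrable_map_measure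
      (Continuous.aestronglyMeasurable (by fun_prop)) (hm p).aemeasurable]
    rcases Nat.eq_zero_or_pos p with rfl | hp
    · simp [Function.comp_def]
    · simpa only [Function.comp_def, hscale hp] using (hint u p).1
  · refine (tendsto_log_mixture (pν u) (pγ u) h0 h1 hw).congr' ?_
    filter_upwards [eventually_gt_atTop 0] with p hp
    rw [meanDisplacementLaw, integral_map (hm p).aemeasurable
      (Continuous.aestronglyMeasurable (by fun_prop))]
    simp only [hscale hp]
    rw [(hint u p).2]

lemma IsAntidiagonalIn.isFullLDP (h : W.IsAntidiagonalIn U ν γ) (hW : W.HasDeformations)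
    (ρ : InitialState d) :
    IsFullLDP (meanDisplacementLaw (W.law ρ))
      (legendre fun u => 1 / 2 * (Real.log (stepMGF ν u) + Real.log (stepMGF γ u))) := by
  have hν := fun u => (h.integrable_exp hW u).1
  have hγ := fun u => (h.integrable_exp hW u).2
  have pν := fun u => stepMGF_pos h.hasSum_normSq.1 (hν u)
  have pγ := fun u => stepMGF_pos h.hasSum_normSq.2 (hγ u)
  refine (h.hasScaledCumulantLimit hW ρ).isFullLDP ?_ fun u v => ?_
  · exact (((continuous_stepMGF hν).log fun u => (pν u).ne').add
      ((continuous_stepMGF hγ).log fun u => (pγ u).ne')).const_mul _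
  · exact (((differentiableAt_stepMGF_line hν pν u v).log (pν _).ne').add
      ((differentiableAt_stepMGF_line hγ pγ u v).log (pγ _).ne')).const_mul _

end OQRW

end OpenQRW

end

theorem mainTheorem7 {d : ℕ} (W : OpenQRW.OQRW d) (hW : W.HasDeformations)
    (h1 : W.H1) (h2 : W.H2)
    (hirr : OpenQRW.IsIrreducible W.L) (hper : OpenQRW.IsPeriodic W.L) :
    (∃ (U : Matrix.unitaryGroup (Fin 2) ℂ) (ν γ : OpenQRW.Lattice d → ℂ),
      W.IsAntidiagonalIn U ν γ) ∧
    ∀ (U : Matrix.unitaryGroup (Fin 2) ℂ) (ν γ : OpenQRW.Lattice d → ℂ),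
      W.IsAntidiagonalIn U ν γ →
      IsProbabilityMeasure (OpenQRW.stepLaw ν) ∧ IsProbabilityMeasure (OpenQRW.stepLaw γ) ∧
      (∀ u : OpenQRW.Space d,
        Integrable (fun s => Real.exp (OpenQRW.pairing u s)) (OpenQRW.stepLaw ν) ∧
        Integrable (fun s => Real.exp (OpenQRW.pairing u s)) (OpenQRW.stepLaw γ) ∧
        spectralRadius ℂ (W.deformed hW u) = ENNReal.ofReal (Real.sqrt
          ((∫ s, Real.exp (OpenQRW.pairing u s) ∂OpenQRW.stepLaw ν) *
            ∫ s, Real.exp (OpenQRW.pairing u s) ∂OpenQRW.stepLaw γ))) ∧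
      ∃ c : OpenQRW.Space d → ℝ,
        (∀ u, c u = 1 / 2 *
          (Real.log (∫ s, Real.exp (OpenQRW.pairing u s) ∂OpenQRW.stepLaw ν) +
            Real.log (∫ s, Real.exp (OpenQRW.pairing u s) ∂OpenQRW.stepLaw γ))) ∧
        (∀ u, c u = Real.log (spectralRadius ℂ (W.deformed hW u)).toReal) ∧
        ∀ ρ : OpenQRW.InitialState d,
          (∀ u, (∀ p : ℕ, Integrable
              (fun ω => Real.exp (OpenQRW.pairing u (ω p - ω 0))) (W.law ρ)) ∧
            Tendsto (fun p : ℕ => 1 / (p : ℝ) * Real.log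
              (∫ ω, Real.exp (OpenQRW.pairing u (ω p - ω 0)) ∂W.law ρ)) atTop (𝓝 (c u))) ∧
          OpenQRW.IsFullLDP (OpenQRW.meanDisplacementLaw (W.law ρ)) (OpenQRW.legendre c) := by
  refine ⟨h1.exists_isAntidiagonalIn hper, fun U ν γ h => ?_⟩
  have hν := fun u => (h.integrable_exp hW u).1
  have hγ := fun u => (h.integrable_exp hW u).2
  have pν := fun u => OpenQRW.stepMGF_pos h.hasSum_normSq.1 (hν u)
  have pγ := fun u => OpenQRW.stepMGF_pos h.hasSum_normSq.2 (hγ u)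
  refine ⟨⟨OpenQRW.stepLaw_univ_eq_one h.hasSum_normSq.1⟩,
    ⟨OpenQRW.stepLaw_univ_eq_one h.hasSum_normSq.2⟩,
    fun u => ⟨hν u, hγ u, h.spectralRadius_deformed hW u⟩,
    fun u => 1 / 2 * (Real.log (OpenQRW.stepMGF ν u) + Real.log (OpenQRW.stepMGF γ u)),
    fun u => rfl, fun u => ?_, fun ρ => ⟨fun u => ?_, h.isFullLDP hW ρ⟩⟩
  · rw [h.spectralRadius_deformed hW u, ENNReal.toReal_ofReal (Real.sqrt_nonneg _),
      Real.log_sqrt (mul_pos (pν u) (pγ u)).le, Real.log_mul (pν u).ne' (pγ u).ne']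
    ring
  · obtain ⟨w₀, w₁, hw0, hw1, hw, hint⟩ := h.exists_integral_exp_displacement hW ρ
    refine ⟨fun p => (hint u p).1, ?_⟩
    simp only [(hint u _).2]
    exact OpenQRW.tendsto_log_mixture (pν u) (pγ u) hw0 hw1 hw
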